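/- Literals are variables $v$ and their complements $\overline{v}$; a clause is a finite set of literals containing no complementary pair, and a clause-set is a finite set of clauses. A clause-set $F$ is minimally unsatisfiable if it is unsatisfiable but every $F \setminus \{C\}$, $C \in F$, is satisfiable; its deficiency is $\delta(F) = |F| - |\mathrm{var}(F)|$, where $\mathrm{var}(F)$ is the set of variables occurring in $F$. A variable $v$ is singular for $F$ if one of the literals $v, \overline{v}$ occurs in exactly one clause of $F$ and the other one in at least one clause of $F$; $F$ is nonsingular if it has no singular variable. For a variable $v$ let $$\mathrm{DP}_v(F) := \{C \in F : v \notin \mathrm{var}(C)\} \cup \{(C \cup D) \setminus \{v, \overline{v}\} : C, D \in F,\ C \cap \overline{D} = \{v\}\},$$ where $\overline{D} := \{\overline{x} : x \in D\}$. A step of singular DP-reduction leads from a minimally unsatisfiable $F$ to a minimally unsatisfiable $\mathrm{DP}_v(F)$ with $v$ singular for $F$. Let $\mathrm{sDP}(F)$ be the set of nonsingular minimally unsatisfiable clause-sets obtainable from $F$ by finitely many (possibly zero) such steps. Two clause-sets are isomorphic if there is a bijection between their literals (the literals over their occurring variables) that preserves complementation and maps the clauses of the first precisely to the clauses of the second.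 For $n \ge 2$ let $\mathcal{D}_n$ be the clause-set over distinct variables $v_1, \dots, v_n$ with the clauses $\{v_1, \dots, v_n\}$, $\{\overline{v_1}, \dots, \overline{v_n}\}$ and $\{\overline{v_i}, v_{i+1}\}$ for $1 \le i \le n$, where $v_{n+1} := v_1$. Theorem. Let $F$ be a minimally unsatisfiable clause-set with $\delta(F) = 2$. Then singular DP-reduction on $F$ is confluent modulo isomorphism, that is, all elements of $\mathrm{sDP}(F)$ are pairwise isomorphic. Moreover, $\mathrm{sDP}(F)$ is non-empty, and there is $n \ge 2$ such that every element of $\mathrm{sDP}(F)$ is isomorphic to $\mathcal{D}_n$; this $n$ is the non-singularity type of $F$, that is, the unique $n \ge 2$ such that $F$ can be reduced by singular DP-reduction to a clause-set isomorphic to $\mathcal{D}_n$. -/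

import Mathlib

/-- Literals over the variable set `V`: `(v, true)` is the positive literal of `v` (identified with
the variable `v`), `(v, false)` is its complement. -/
abbrev Lit (V : Type*) := V × Bool

/-- Complementation of literals. -/
def Lit.compl {V : Type*} (x : Lit V) : Lit V := (x.1, !x.2)

/-- Finite sets of literals. A clause is such a set that is moreover clash-free,
see `Clause.ClashFree`. -/
abbrev Clause (V : Type*) := Finset (Lit V)

/-- Finite sets of finite sets of literals. A clause-set is such a set all of whose elements are
clash-free, see `ClauseSet.IsClauseSet`. -/
abbrev ClauseSet (V : Type*) := Finset (Clause V)

namespace Clause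

variable {V : Type*} [DecidableEq V]

/-- The set of complements of the literals of `C`. -/
def compl (C : Clause V) : Clause V := C.image Lit.compl

/-- `C` contains no pair of complementary literals. -/
def ClashFree (C : Clause V) : Prop := C ∩ C.compl = ∅

/-- The variables of `C`. -/
def vars (C : Clause V) : Finset V := C.image Prod.fst

/-- The resolvent of `C` and `D` on the variable `v`. -/
def resolvent (v : V) (C D : Clause V) : Clause V := (C ∪ D) \ {(v, true), (v, false)}

end Clause

namespace ClauseSet

variable {V : Type*} [DecidableEq V]

/-- All elements of `F` are clauses, that is, clash-free. -/
def IsClauseSet (F : ClauseSet V) : Prop := ∀ C ∈ F, C.ClashFree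

/-- The variables occurring in `F`. -/
def vars (F : ClauseSet V) : Finset V := F.biUnion Clause.vars

/-- The deficiency: number of clauses minus number of variables. -/
def deficiency (F : ClauseSet V) : ℤ := (F.card : ℤ) - (F.vars.card : ℤ)

/-- The number of clauses of `F` containing the literal `x`. -/
def ldeg (F : ClauseSet V) (x : Lit V) : ℕ := (F.filter fun C => x ∈ C).card

/-- Some truth assignment makes at least one literal of every clause of `F` true. -/
def Satisfiable {V : Type*} (F : ClauseSet V) : Prop :=
  ∃ f : V → Bool, ∀ C ∈ F, ∃ x ∈ C, f x.1 = x.2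

/-- Minimally unsatisfiable clause-sets. -/
def MinUnsat (F : ClauseSet V) : Prop :=
  F.IsClauseSet ∧ ¬ F.Satisfiable ∧ ∀ C ∈ F, Satisfiable (F.erase C)

/-- DP-reduction on `v`: all clauses containing the variable `v` are replaced by the resolvents
on `v` of those pairs of clauses which clash exactly in `v`. -/
def dp (v : V) (F : ClauseSet V) : ClauseSet V :=
  (F.filter fun C => v ∉ C.vars) ∪
    ((F ×ˢ F).filter fun p => p.1 ∩ p.2.compl = {(v, true)}).image
      fun p => Clause.resolvent v p.1 p.2

/-- `v` is a singular variable of `F`. -/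
def Singular (F : ClauseSet V) (v : V) : Prop :=
  min (F.ldeg (v, true)) (F.ldeg (v, false)) = 1

/-- `F` has no singular variable. -/
def Nonsingular (F : ClauseSet V) : Prop := ∀ v, ¬ F.Singular v

/-- One step of singular DP-reduction between minimally unsatisfiable clause-sets. -/
def SDPStep (F F' : ClauseSet V) : Prop :=
  F.MinUnsat ∧ F'.MinUnsat ∧ ∃ v, F.Singular v ∧ F' = F.dp v

/-- Zero, one or more steps of singular DP-reduction. -/
def SDPReduces (F F' : ClauseSet V) : Prop := Relation.ReflTransGen SDPStep F F'

/-- The set of results of complete singular DP-reduction of `F`. -/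
def sDP (F : ClauseSet V) : Set (ClauseSet V) :=
  {F' | F'.MinUnsat ∧ F'.Nonsingular ∧ F.SDPReduces F'}

/-- The literals over the variables occurring in `F`. -/
abbrev LitOf (F : ClauseSet V) := {x : Lit V // x.1 ∈ F.vars}

/-- Complementation on the literals over the variables of `F`. -/
def LitOf.compl {F : ClauseSet V} (x : F.LitOf) : F.LitOf := ⟨x.1.compl, x.2⟩

/-- Isomorphism of clause-sets, possibly over different sets of variables: a bijection between
their literals which preserves complementation and maps the clauses of `F` precisely to the clauses
of `G`. (Every clause of `F` is of the form `C.map (.subtype _)`.) -/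
def Iso {W : Type*} [DecidableEq W] (F : ClauseSet V) (G : ClauseSet W) : Prop :=
  ∃ e : F.LitOf ≃ G.LitOf, (∀ x, e x.compl = (e x).compl) ∧
    ∀ C : Finset F.LitOf,
      C.map (.subtype _) ∈ F ↔ (C.map e.toEmbedding).map (.subtype _) ∈ G

/-- `F` is minimally unsatisfiable, and singular DP-reduction on `F` is confluent modulo
isomorphism. -/
def ConfluentModIso (F : ClauseSet V) : Prop :=
  F.MinUnsat ∧ ∀ F' ∈ F.sDP, ∀ F'' ∈ F.sDP, F'.Iso F''

/-- The clause-set with the clauses `{v₁, …, vₙ}`, `{¬v₁, …, ¬vₙ}` and `{¬vᵢ, vᵢ₊₁}`, indices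
modulo `n`; the variables are the elements of `Fin n`, and `finRotate n` is the cyclic successor.
Only used for `n ≥ 2`. -/
def cycle (n : ℕ) : ClauseSet (Fin n) :=
  {Finset.univ.image fun i => (i, true), Finset.univ.image fun i => (i, false)} ∪
    Finset.univ.image fun i => {(i, false), (finRotate n i, true)}

/-- `F` can be reduced by singular DP-reduction to a clause-set isomorphic to `cycle n`. -/
def HasNonsingularityType (F : ClauseSet V) (n : ℕ) : Prop :=
  2 ≤ n ∧ ∃ F', F.SDPReduces F' ∧ F'.Iso (cycle n)

end ClauseSet

/-! Singular DP-reduction preserves minimal unsatisfiability and deficiency, so two facts suffice: a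
nonsingular minimally unsatisfiable clause-set of deficiency 2 is a cycle up to renaming and
flipping of variables, and all elements of `sDP` have equally many variables. The number of
variables determines the cycle up to isomorphism.

The second fact (`MinUnsat.card_vars_eq`) is an induction on the number of variables, with a weak
diamond. Two singular variables with different main clauses commute (`MinUnsat.dp_comm`). If they
share the main clause, every variable that is singular after reducing one of them was singular
before with another main clause, so it commutes with both; if there is none after either reduction,
both reductions are already final.

For the first fact (`MinUnsat.exists_eq_cycleOn`) the clauses are enlarged until saturated.
Assigning a variable of fewest occurrences then gives minimally unsatisfiable families, whose
deficiency is at least 1; so this variable occurs exactly twice in each sign, and both restrictions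
have deficiency 1. There two clauses clash in at most one variable, and some variable occurs exactly
once in each sign. In a restriction of the nonsingular family such a variable must have lost an
occurrence of either sign to the two deleted clauses, so these clash in it; hence it is unique. This
uniqueness makes the restriction a chain, and the two restrictions together yield a cycle. In a
cycle every literal has degree 2, the least degree possible in the original clause-set, so the
enlargement added nothing.

The combinatorics is done for indexed families, where a reduction deletes one index and every other
clause keeps its own. -/

/-! ### Literals and truth assignments -/

namespace Lit

variable {V : Type*}

@[simp] theorem compl_fst (x : Lit V) : x.compl.1 = x.1 := rfl

@[simp] theorem compl_snd (x : Lit V) : x.compl.2 = !x.2 := rfl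

@[simp] theorem compl_compl (x : Lit V) : x.compl.compl = x := by
  simp [Lit.compl]

theorem compl_ne (x : Lit V) : x.compl ≠ x := by
  intro h
  have := congrArg Prod.snd h
  simp at this

theorem compl_injective : Function.Injective (Lit.compl (V := V)) := fun x y h => by
  rw [← compl_compl x, h, compl_compl]

theorem compl_eq_comm {x y : Lit V} : x.compl = y ↔ x = y.compl :=
  ⟨fun h => by rw [← h, compl_compl], fun h => by rw [h, compl_compl]⟩

theorem eq_or_eq_compl {x y : Lit V} (h : x.1 = y.1) : x = y ∨ x = y.compl := by
  by_cases h2 : x.2 = y.2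
  · exact Or.inl (Prod.ext h h2)
  · exact Or.inr (Prod.ext h (by revert h2; cases x.2 <;> cases hy : y.2 <;> simp [hy]))

/-- The literal `x` is true under `f`. -/
def Holds (f : V → Bool) (x : Lit V) : Prop := f x.1 = x.2

theorem holds_compl {f : V → Bool} {x : Lit V} : Holds f x.compl ↔ ¬ Holds f x := by
  simp only [Holds, compl_fst, compl_snd]
  cases f x.1 <;> cases x.2 <;> simp

variable [DecidableEq V]

theorem holds_update_self (f : V → Bool) (x : Lit V) : Holds (Function.update f x.1 x.2) x := by
  simp [Holds]

theorem holds_update_of_ne {f : V → Bool} {x y : Lit V} (h : y.1 ≠ x.1) :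
    Holds (Function.update f x.1 x.2) y ↔ Holds f y := by
  simp [Holds, Function.update_of_ne h]

theorem Holds.update {f : V → Bool} {x y : Lit V} (h : Holds f y) (hy : y ≠ x.compl) :
    Holds (Function.update f x.1 x.2) y := by
  by_cases e : y.1 = x.1
  · rcases eq_or_eq_compl e with rfl | h'
    · exact holds_update_self f y
    · exact absurd h' hy
  · exact (holds_update_of_ne e).2 h

end Lit

/-! ### Minimally unsatisfiable families and their singular DP-reduction -/

/-- `(s, G)` is a minimally unsatisfiable family of clauses. -/
structure FamMU {V ι : Type*} (s : Finset ι) (G : ι → Clause V) : Prop where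
  clashFree : ∀ i ∈ s, ∀ y ∈ G i, y.compl ∉ G i
  unsat : ∀ f : V → Bool, ∃ i ∈ s, ∀ y ∈ G i, ¬ y.Holds f
  critical : ∀ i ∈ s, ∃ f : V → Bool, ∀ j ∈ s, j ≠ i → ∃ y ∈ G j, y.Holds f

/-- The literal `a` occurs in the family only in the clause with index `c`, and its complement
occurs somewhere. -/
structure FamSing {V ι : Type*} (s : Finset ι) (G : ι → Clause V) (a : Lit V) (c : ι) :
    Prop where
  mem : c ∈ s
  lit_mem : a ∈ G c
  unique : ∀ j ∈ s, a ∈ G j → j = c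
  compl_mem : ∃ j ∈ s, a.compl ∈ G j

theorem FamMU.exists_critical {V ι : Type*} {s : Finset ι} {G : ι → Clause V}
    (h : FamMU s G) {i : ι} (hi : i ∈ s) : ∃ f : V → Bool,
    (∀ j ∈ s, j ≠ i → ∃ y ∈ G j, y.Holds f) ∧ ∀ y ∈ G i, ¬ y.Holds f := by
  obtain ⟨f, hf⟩ := h.critical i hi
  refine ⟨f, hf, ?_⟩
  obtain ⟨j, hj, hj'⟩ := h.unsat f
  by_cases e : j = i
  · exact e ▸ hj'
  · obtain ⟨y, hy, hy'⟩ := hf j hj e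
    exact absurd hy' (hj' y hy)

/-- No clause of a minimally unsatisfiable family contains another one. -/
theorem FamMU.eq_of_subset {V ι : Type*} {s : Finset ι} {G : ι → Clause V}
    (h : FamMU s G) {i j : ι} (hi : i ∈ s) (hj : j ∈ s) (hij : G i ⊆ G j) :
    i = j := by
  by_contra e
  obtain ⟨f, hf, hf'⟩ := h.exists_critical hj
  obtain ⟨y, hy, hy'⟩ := hf i hi e
  exact hf' y (hij hy) hy'

theorem FamMU.injOn {V ι : Type*} {s : Finset ι} {G : ι → Clause V} (h : FamMU s G) :
    Set.InjOn G s := fun _ hi _ hj e =>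
  h.eq_of_subset hi hj e.subset

section Family

variable {V ι : Type*} [DecidableEq V]

/-- The variables of a family of clauses. -/
def famVars (s : Finset ι) (G : ι → Clause V) : Finset V := s.biUnion fun i => (G i).vars

/-- The number of members of a family containing a given literal. -/
def famDeg (s : Finset ι) (G : ι → Clause V) (y : Lit V) : ℕ := (s.filter fun i => y ∈ G i).card

/-- Singular DP-reduction of a family with respect to the literal `a` occurring only in the clause
with index `c`, which disappears from the index set. -/
def famDP (G : ι → Clause V) (a : Lit V) (c : ι) : ι → Clause V := fun i =>
  if a.compl ∈ G i then (G c).erase a ∪ (G i).erase a.compl else G i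

theorem Clause.mem_vars {C : Clause V} {v : V} : v ∈ C.vars ↔ ∃ y ∈ C, y.1 = v := by
  simp [Clause.vars]

theorem mem_famVars {s : Finset ι} {G : ι → Clause V} {v : V} :
    v ∈ famVars s G ↔ ∃ i ∈ s, ∃ y ∈ G i, y.1 = v := by
  simp [famVars, Clause.mem_vars]

theorem fst_mem_famVars {s : Finset ι} {G : ι → Clause V} {i : ι} {y : Lit V} (hi : i ∈ s)
    (hy : y ∈ G i) : y.1 ∈ famVars s G := mem_famVars.2 ⟨i, hi, y, hy, rfl⟩

variable {s : Finset ι} {G : ι → Clause V}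

theorem famDeg_pos {y : Lit V} : 0 < famDeg s G y ↔ ∃ i ∈ s, y ∈ G i := by
  simp [famDeg, Finset.card_pos, Finset.Nonempty]

theorem famDeg_eq_one {y : Lit V} :
    famDeg s G y = 1 ↔ ∃ i ∈ s, y ∈ G i ∧ ∀ j ∈ s, y ∈ G j → j = i := by
  simp only [famDeg, Finset.card_eq_one, Finset.eq_singleton_iff_unique_mem, Finset.mem_filter]
  grind

theorem two_le_famDeg {y : Lit V} :
    2 ≤ famDeg s G y ↔ ∃ i ∈ s, ∃ j ∈ s, i ≠ j ∧ y ∈ G i ∧ y ∈ G j := by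
  have : 2 ≤ famDeg s G y ↔ 1 < famDeg s G y := Iff.rfl
  rw [this, famDeg, Finset.one_lt_card]
  simp only [Finset.mem_filter]
  grind

theorem mem_famDP {a y : Lit V} {c i : ι} :
    y ∈ famDP G a c i ↔
      (a.compl ∈ G i ∧ ((y ∈ G c ∧ y ≠ a) ∨ (y ∈ G i ∧ y ≠ a.compl))) ∨
        (a.compl ∉ G i ∧ y ∈ G i) := by
  unfold famDP
  split_ifs with h <;> simp [h, and_comm]

namespace FamMU

/-- Without an occurrence of `y.compl`, making `y` true in an assignment critical for `i` would
satisfy every clause. -/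
theorem exists_compl_mem (h : FamMU s G) {i : ι} (hi : i ∈ s) {y : Lit V} (hy : y ∈ G i) :
    ∃ j ∈ s, y.compl ∈ G j := by
  by_contra! hc
  obtain ⟨f, hf, -⟩ := h.exists_critical hi
  obtain ⟨j, hj, hj'⟩ := h.unsat (Function.update f y.1 y.2)
  by_cases e : j = i
  · exact hj' y (e ▸ hy) (Lit.holds_update_self f y)
  · obtain ⟨z, hz, hz'⟩ := hf j hj e
    exact hj' z hz (hz'.update (fun e => hc j hj (e ▸ hz)))

theorem exists_mem_of_fst_mem (h : FamMU s G) {y : Lit V} (hy : y.1 ∈ famVars s G) :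
    ∃ i ∈ s, y ∈ G i := by
  obtain ⟨i, hi, z, hz, e⟩ := mem_famVars.1 hy
  rcases Lit.eq_or_eq_compl e with rfl | rfl
  · exact ⟨i, hi, hz⟩
  · simpa using h.exists_compl_mem hi hz

variable {a : Lit V} {c : ι}

/-- The main clause of a singular literal clashes with the other clauses containing the complement
only in that literal. -/
theorem compl_notMem_of_sing (h : FamMU s G) (ha : FamSing s G a c) {i : ι} (hi : i ∈ s)
    (hai : a.compl ∈ G i) {y : Lit V} (hy : y ∈ G c) (hya : y ≠ a) : y.compl ∉ G i := by
  intro hyi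
  obtain ⟨f, hf, hf'⟩ := h.exists_critical hi
  -- Making `a` false in an assignment that falsifies only clause `i` would satisfy everything: `i`
  -- by `a.compl`, `c` by `y`, and the other clauses do not contain `a`.
  obtain ⟨j, hj, hj'⟩ := h.unsat (Function.update f a.compl.1 a.compl.2)
  have hne : y.1 ≠ a.1 := by
    intro e
    rcases Lit.eq_or_eq_compl e with rfl | rfl
    · exact hya rfl
    · exact h.clashFree c ha.mem a ha.lit_mem hy
  by_cases hjc : j = c
  · subst hjc
    refine hj' y hy ((Lit.holds_update_of_ne (x := a.compl) hne).2 ?_)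
    have := hf' _ hyi
    rwa [Lit.holds_compl, not_not] at this
  · by_cases hji : j = i
    · exact hj' a.compl (hji ▸ hai) (Lit.holds_update_self f a.compl)
    · obtain ⟨z, hz, hz'⟩ := hf j hj hji
      refine hj' z hz (hz'.update fun e => hjc (ha.unique j hj ?_))
      rw [Lit.compl_compl] at e
      exact e ▸ hz

variable [DecidableEq ι]

/-- A model of the reduced family would extend to `G`: make `a` false if clause `c` has another true
literal, and true otherwise. Critical assignments need no change: if `a` is true, a true literal of
a clause is not `a.compl` and survives; if `a` is false, the literal that satisfies clause `c`
enters every resolvent. -/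
theorem famMU_famDP (h : FamMU s G) (ha : FamSing s G a c) : FamMU (s.erase c) (famDP G a c) := by
  have hac : ∀ i ∈ s, i ≠ c → a ∉ G i := fun i hi hic hai => hic (ha.unique i hi hai)
  refine ⟨?_, ?_, ?_⟩
  · intro i hi y hy hy'
    obtain ⟨hic, hi⟩ := Finset.mem_erase.1 hi
    rw [mem_famDP] at hy hy'
    rcases hy with ⟨hai, hy⟩ | ⟨hai, hy⟩
    · rcases hy' with ⟨-, hy'⟩ | ⟨h', -⟩
      · rcases hy with ⟨hy, hya⟩ | ⟨hy, hya⟩ <;> rcases hy' with ⟨hy', hya'⟩ | ⟨hy', hya'⟩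
        · exact h.clashFree c ha.mem y hy hy'
        · exact h.compl_notMem_of_sing ha hi hai hy hya hy'
        · exact h.compl_notMem_of_sing ha hi hai hy' hya' (by simpa using hy)
        · exact h.clashFree i hi y hy hy'
      · exact h' hai
    · rcases hy' with ⟨h', -⟩ | ⟨-, hy'⟩
      · exact hai h'
      · exact h.clashFree i hi y hy hy'
  · intro f
    by_contra! hc
    have hc' : ∀ i ∈ s, i ≠ c → ∃ y, y ∈ famDP G a c i ∧ y.Holds f := fun i hi hic =>
      hc i (Finset.mem_erase.2 ⟨hic, hi⟩)
    by_cases hC : ∃ y ∈ G c, y ≠ a ∧ y.Holds f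
    · obtain ⟨y, hy, hya, hyf⟩ := hC
      obtain ⟨j, hj, hj'⟩ := h.unsat (Function.update f a.compl.1 a.compl.2)
      by_cases hjc : j = c
      · subst hjc
        exact hj' y hy (hyf.update (by simpa using hya))
      · by_cases haj : a.compl ∈ G j
        · exact hj' _ haj (Lit.holds_update_self f _)
        · obtain ⟨z, hz, hzf⟩ := hc' j hj hjc
          rw [mem_famDP] at hz
          have hz : z ∈ G j := by tauto
          refine hj' z hz (hzf.update ?_)
          rintro rfl
          exact hac j hj hjc (by simpa using hz)
    · push Not at hC
      obtain ⟨j, hj, hj'⟩ := h.unsat (Function.update f a.1 a.2)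
      by_cases hjc : j = c
      · subst hjc
        exact hj' a ha.lit_mem (Lit.holds_update_self f a)
      · obtain ⟨z, hz, hzf⟩ := hc' j hj hjc
        rw [mem_famDP] at hz
        rcases hz with ⟨haj, ⟨hz, hza⟩ | ⟨hz, hza⟩⟩ | ⟨haj, hz⟩
        · exact hC z hz hza hzf
        · exact hj' z hz (hzf.update hza)
        · exact hj' z hz (hzf.update fun e => haj (e ▸ hz))
  · intro i hi
    obtain ⟨hic, hi⟩ := Finset.mem_erase.1 hi
    obtain ⟨f, hf, hf'⟩ := h.exists_critical hi
    by_cases haf : a.Holds f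
    · refine ⟨f, fun j hj hji => ?_⟩
      obtain ⟨hjc, hj⟩ := Finset.mem_erase.1 hj
      obtain ⟨z, hz, hzf⟩ := hf j hj hji
      refine ⟨z, ?_, hzf⟩
      have : z ≠ a.compl := by
        rintro rfl
        exact Lit.holds_compl.1 hzf haf
      rw [mem_famDP]
      tauto
    · refine ⟨f, fun j hj hji => ?_⟩
      obtain ⟨hjc, hj⟩ := Finset.mem_erase.1 hj
      by_cases haj : a.compl ∈ G j
      · obtain ⟨z, hz, hzf⟩ := hf c ha.mem (Ne.symm hic)
        refine ⟨z, mem_famDP.2 (Or.inl ⟨haj, Or.inl ⟨hz, ?_⟩⟩), hzf⟩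
        rintro rfl
        exact haf hzf
      · obtain ⟨z, hz, hzf⟩ := hf j hj hji
        exact ⟨z, mem_famDP.2 (Or.inr ⟨haj, hz⟩), hzf⟩

theorem famVars_famDP (h : FamMU s G) (ha : FamSing s G a c) :
    famVars (s.erase c) (famDP G a c) = (famVars s G).erase a.1 := by
  ext v
  simp only [Finset.mem_erase, mem_famVars, mem_famDP]
  constructor
  · rintro ⟨i, ⟨hic, hi⟩, y, hy, rfl⟩
    have hai : a ∉ G i := fun hai => hic (ha.unique i hi hai)
    have hac := h.clashFree c ha.mem a ha.lit_mem
    constructor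
    · intro e
      rcases Lit.eq_or_eq_compl e with rfl | rfl
      · tauto
      · tauto
    · rcases hy with ⟨-, ⟨hy, -⟩ | ⟨hy, -⟩⟩ | ⟨-, hy⟩
      exacts [⟨c, ha.mem, y, hy, rfl⟩, ⟨i, hi, y, hy, rfl⟩, ⟨i, hi, y, hy, rfl⟩]
  · rintro ⟨hv, i, hi, y, hy, rfl⟩
    have hya : y ≠ a := fun e => hv (e ▸ rfl)
    have hya' : y ≠ a.compl := fun e => hv (e ▸ rfl)
    by_cases hic : i = c
    · subst hic
      obtain ⟨j, hj, haj⟩ := ha.compl_mem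
      refine ⟨j, ⟨?_, hj⟩, y, Or.inl ⟨haj, Or.inl ⟨hy, hya⟩⟩, rfl⟩
      rintro rfl
      exact h.clashFree j hj a ha.lit_mem haj
    · refine ⟨i, ⟨hic, hi⟩, y, ?_, rfl⟩
      tauto

end FamMU

end Family

/-! ### Transfer between families and clause-sets; commuting reductions -/

section Bridge

variable {V ι : Type*} [DecidableEq V] {s : Finset ι} {G : ι → Clause V}

theorem Clause.mem_compl {C : Clause V} {y : Lit V} : y ∈ C.compl ↔ y.compl ∈ C := by
  simp only [Clause.compl, Finset.mem_image]
  exact ⟨fun ⟨z, hz, e⟩ => by rwa [← e, Lit.compl_compl], fun h => ⟨_, h, Lit.compl_compl y⟩⟩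

theorem Clause.clashFree_iff {C : Clause V} : C.ClashFree ↔ ∀ y ∈ C, y.compl ∉ C := by
  simp [Clause.ClashFree, Finset.ext_iff, Clause.mem_compl]

namespace ClauseSet

theorem minUnsat_iff {F : ClauseSet V} : F.MinUnsat ↔ FamMU F id := by
  constructor
  · rintro ⟨h1, h2, h3⟩
    refine ⟨fun C hC => Clause.clashFree_iff.1 (h1 C hC), fun f => ?_, fun C hC => ?_⟩
    · by_contra! hc
      exact h2 ⟨f, hc⟩
    · obtain ⟨f, hf⟩ := h3 C hC
      exact ⟨f, fun D hD hDC => hf D (Finset.mem_erase.2 ⟨hDC, hD⟩)⟩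
  · rintro ⟨h1, h2, h3⟩
    refine ⟨fun C hC => Clause.clashFree_iff.2 (h1 C hC), fun ⟨f, hf⟩ => ?_, fun C hC => ?_⟩
    · obtain ⟨C, hC, hC'⟩ := h2 f
      obtain ⟨y, hy, hyf⟩ := hf C hC
      exact hC' y hy hyf
    · obtain ⟨f, hf⟩ := h3 C hC
      exact ⟨f, fun D hD => hf D (Finset.mem_erase.1 hD).2 (Finset.mem_erase.1 hD).1⟩

theorem vars_image (s : Finset ι) (G : ι → Clause V) : vars (s.image G) = famVars s G := by
  simp [vars, famVars, Finset.image_biUnion]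

theorem ldeg_image (hG : Set.InjOn G s) (y : Lit V) : ldeg (s.image G) y = famDeg s G y := by
  rw [ldeg, famDeg, Finset.filter_image, Finset.card_image_of_injOn]
  exact hG.mono fun i hi => (Finset.mem_filter.1 hi).1

/-- The definition of `dp` singles out the positive literal. Clashing is symmetric, so the
description holds for both signs, and `a` can be whichever literal is singular. -/
theorem mem_dp {F : ClauseSet V} {a : Lit V} {C : Clause V} : C ∈ F.dp a.1 ↔
    (C ∈ F ∧ a ∉ C ∧ a.compl ∉ C) ∨ ∃ P ∈ F, ∃ Q ∈ F, P ∩ Q.compl = {a} ∧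
      C = (P ∪ Q) \ {a, a.compl} := by
  have hv : ∀ C : Clause V, a.1 ∉ C.vars ↔ a ∉ C ∧ a.compl ∉ C := by
    intro C
    rw [Clause.mem_vars]
    constructor
    · intro h
      exact ⟨fun h' => h ⟨_, h', rfl⟩, fun h' => h ⟨_, h', rfl⟩⟩
    · rintro ⟨h1, h2⟩ ⟨y, hy, e⟩
      rcases Lit.eq_or_eq_compl e with rfl | rfl
      · exact h1 hy
      · exact h2 hy
  have hs : ∀ (P Q : Clause V) (x : Lit V), P ∩ Q.compl = {x} ↔ Q ∩ P.compl = {x.compl} := by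
    have : ∀ (P Q : Clause V) (x : Lit V), P ∩ Q.compl = {x} → Q ∩ P.compl = {x.compl} := by
      intro P Q x h
      ext y
      have := Finset.ext_iff.1 h y.compl
      simp only [Finset.mem_inter, Clause.mem_compl, Finset.mem_singleton,
        Lit.compl_compl] at this ⊢
      rw [and_comm, this, Lit.compl_eq_comm]
    intro P Q x
    exact ⟨this P Q x, fun h => by simpa using this Q P _ h⟩
  simp only [dp, Finset.mem_union, Finset.mem_filter, hv, Finset.mem_image, Finset.mem_product,
    Prod.exists, Clause.resolvent]
  refine or_congr Iff.rfl ?_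
  obtain ⟨v, b⟩ := a
  cases b
  · constructor
    · rintro ⟨P, Q, ⟨⟨hP, hQ⟩, h⟩, rfl⟩
      refine ⟨Q, hQ, P, hP, (hs _ _ _).1 h, ?_⟩
      rw [Finset.union_comm, Finset.pair_comm]; rfl
    · rintro ⟨P, hP, Q, hQ, h, rfl⟩
      refine ⟨Q, P, ⟨⟨hQ, hP⟩, (hs _ _ _).1 h⟩, ?_⟩
      rw [Finset.union_comm, Finset.pair_comm]; rfl
  · constructor
    · rintro ⟨P, Q, ⟨⟨hP, hQ⟩, h⟩, rfl⟩
      exact ⟨P, hP, Q, hQ, h, rfl⟩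
    · rintro ⟨P, hP, Q, hQ, h, rfl⟩
      exact ⟨P, Q, ⟨⟨hP, hQ⟩, h⟩, rfl⟩

end ClauseSet

open ClauseSet

theorem FamMU.minUnsat (h : FamMU s G) : MinUnsat (s.image G) := by
  rw [minUnsat_iff]
  refine ⟨?_, ?_, ?_⟩
  · intro C hC
    obtain ⟨i, hi, rfl⟩ := Finset.mem_image.1 hC
    exact h.clashFree i hi
  · intro f
    obtain ⟨i, hi, hf⟩ := h.unsat f
    exact ⟨G i, Finset.mem_image_of_mem G hi, hf⟩
  · intro C hC
    obtain ⟨i, hi, rfl⟩ := Finset.mem_image.1 hC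
    obtain ⟨f, hf⟩ := h.critical i hi
    refine ⟨f, fun D hD hDC => ?_⟩
    obtain ⟨j, hj, rfl⟩ := Finset.mem_image.1 hD
    exact hf j hj fun e => hDC (e ▸ rfl)

theorem FamMU.singular_iff (h : FamMU s G) {v : V} :
    Singular (s.image G) v ↔ ∃ a c, a.1 = v ∧ FamSing s G a c := by
  have key : ∀ b : Bool, (famDeg s G (v, b) = 1 ∧ 0 < famDeg s G (v, !b)) ↔
      ∃ c, FamSing s G (v, b) c := by
    intro b
    rw [famDeg_eq_one, famDeg_pos]
    constructor
    · rintro ⟨⟨i, hi, hy, hu⟩, hc⟩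
      exact ⟨i, hi, hy, hu, hc⟩
    · rintro ⟨c, hc⟩
      exact ⟨⟨c, hc.mem, hc.lit_mem, hc.unique⟩, hc.compl_mem⟩
  rw [Singular, ldeg_image h.injOn, ldeg_image h.injOn]
  constructor
  · intro hm
    rcases le_total (famDeg s G (v, true)) (famDeg s G (v, false)) with hl | hl
    · rw [min_eq_left hl] at hm
      obtain ⟨c, hc⟩ := (key true).1 ⟨hm, by simp; omega⟩
      exact ⟨_, c, rfl, hc⟩
    · rw [min_eq_right hl] at hm
      obtain ⟨c, hc⟩ := (key false).1 ⟨hm, by simp; omega⟩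
      exact ⟨_, c, rfl, hc⟩
  · rintro ⟨⟨v, b⟩, c, rfl, hc⟩
    have := (key b).2 ⟨c, hc⟩
    cases b <;> simp at this <;> simp <;> omega

/-- The critical case is that each of the main clauses contains the complement of the singular
literal of the other. They would then clash in two variables, against `compl_notMem_of_sing`; this
is `hx`. The rest is a case distinction on where the complements occur. -/
theorem FamMU.famDP_comm (h : FamMU s G) {a b : Lit V} {c d : ι} (ha : FamSing s G a c)
    (hb : FamSing s G b d) (hcd : c ≠ d) (hab : a.1 ≠ b.1) {i : ι} (hi : i ∈ s) (hic : i ≠ c)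
    (hid : i ≠ d) : famDP (famDP G a c) b d i = famDP (famDP G b d) a c i := by
  have hne : b ≠ a := fun e => hab (e ▸ rfl)
  have hne' : b ≠ a.compl := fun e => hab (e ▸ rfl)
  have hnc : b.compl ≠ a := fun e => hab (e ▸ rfl)
  have hnc' : b.compl ≠ a.compl := fun e => hne (Lit.compl_injective e)
  have hbc : b ∉ G c := fun h' => hcd (hb.unique c ha.mem h')
  have had : a ∉ G d := fun h' => hcd (ha.unique d hb.mem h').symm
  have hai : a ∉ G i := fun h' => hic (ha.unique i hi h')
  have hbi : b ∉ G i := fun h' => hid (hb.unique i hi h')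
  have hacc : a.compl ∉ G c := h.clashFree c ha.mem a ha.lit_mem
  have hbdc : b.compl ∉ G d := h.clashFree d hb.mem b hb.lit_mem
  have hx : ¬ (a.compl ∈ G d ∧ b.compl ∈ G c) := by
    rintro ⟨h1, h2⟩
    exact h.compl_notMem_of_sing ha hb.mem h1 h2 hnc (by simpa using hb.lit_mem)
  ext y
  simp only [mem_famDP]
  have e1 : y = a → y ≠ b ∧ y ≠ a.compl ∧ y ≠ b.compl := by
    rintro rfl
    exact ⟨hne.symm, (Lit.compl_ne y).symm, hnc.symm⟩
  have e2 : y = b → y ≠ a ∧ y ≠ a.compl ∧ y ≠ b.compl := by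
    rintro rfl
    exact ⟨hne, hne', (Lit.compl_ne y).symm⟩
  by_cases h1 : a.compl ∈ G i <;> by_cases h2 : b.compl ∈ G i <;> by_cases h3 : a.compl ∈ G d <;>
    by_cases h4 : b.compl ∈ G c <;>
    simp only [h1, h2, h3, h4, hnc, hnc', hnc'.symm, ne_eq, not_true, not_false_eq_true,
      true_and, and_true, false_and, and_false, or_false, false_or, or_true] <;> grind

variable [DecidableEq ι]

/-- Clause `c` is the only possible parent containing `a`, and it clashes with each partner in `a`
alone. So each clause containing `a.compl` yields exactly one resolvent, kept at its own index. -/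
theorem FamMU.dp_image (h : FamMU s G) {a : Lit V} {c : ι} (ha : FamSing s G a c) :
    dp a.1 (s.image G) = (s.erase c).image (famDP G a c) := by
  have hac : a.compl ∉ G c := h.clashFree c ha.mem a ha.lit_mem
  ext C
  rw [mem_dp, Finset.mem_image (f := famDP G a c)]
  have hres : ∀ i ∈ s, a.compl ∈ G i → i ≠ c ∧ (G c ∪ G i) \ {a, a.compl} = famDP G a c i := by
    intro i hi hai
    have hic : i ≠ c := by rintro rfl; exact hac hai
    refine ⟨hic, ?_⟩
    have : a ∉ G i := fun h' => hic (ha.unique i hi h')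
    ext y
    simp only [Finset.mem_sdiff, Finset.mem_union, Finset.mem_insert, Finset.mem_singleton,
      mem_famDP]
    by_cases e1 : y = a
    · subst e1; simp [(Lit.compl_ne y).symm, hai, this]
    · by_cases e2 : y = a.compl
      · subst e2; simp [hac, hai, e1]
      · simp [e1, e2, hai]
  constructor
  · rintro (⟨hC, h1, h2⟩ | ⟨P, hP, Q, hQ, hPQ, rfl⟩)
    · obtain ⟨i, hi, rfl⟩ := Finset.mem_image.1 hC
      refine ⟨i, Finset.mem_erase.2 ⟨?_, hi⟩, ?_⟩
      · rintro rfl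
        exact h1 ha.lit_mem
      · simp [famDP, h2]
    · obtain ⟨i, hi, rfl⟩ := Finset.mem_image.1 hP
      obtain ⟨j, hj, rfl⟩ := Finset.mem_image.1 hQ
      have := Finset.ext_iff.1 hPQ a
      simp only [Finset.mem_inter, Clause.mem_compl, Finset.mem_singleton, iff_true] at this
      obtain rfl := ha.unique i hi this.1
      obtain ⟨hjc, e⟩ := hres j hj this.2
      exact ⟨j, Finset.mem_erase.2 ⟨hjc, hj⟩, e.symm⟩
  · rintro ⟨i, hi, rfl⟩
    obtain ⟨hic, hi⟩ := Finset.mem_erase.1 hi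
    by_cases hai : a.compl ∈ G i
    · refine Or.inr ⟨G c, Finset.mem_image_of_mem G ha.mem, G i, Finset.mem_image_of_mem G hi, ?_,
        (hres i hi hai).2.symm⟩
      ext y
      simp only [Finset.mem_inter, Clause.mem_compl, Finset.mem_singleton]
      constructor
      · rintro ⟨h1, h2⟩
        by_contra hya
        exact h.compl_notMem_of_sing ha hi hai h1 hya h2
      · rintro rfl
        exact ⟨ha.lit_mem, hai⟩
    · refine Or.inl ?_
      have e : famDP G a c i = G i := by simp [famDP, hai]
      rw [e]
      exact ⟨Finset.mem_image_of_mem G hi, fun h' => hic (ha.unique i hi h'), hai⟩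

/-- A singular literal remains singular after singular DP-reduction with another main clause. -/
theorem FamMU.sing_famDP (h : FamMU s G) {a b : Lit V} {c d : ι} (ha : FamSing s G a c)
    (hb : FamSing s G b d) (hcd : c ≠ d) (hab : a.1 ≠ b.1) :
    FamSing (s.erase c) (famDP G a c) b d := by
  have hne : b ≠ a := fun e => hab (e ▸ rfl)
  have hne' : b ≠ a.compl := fun e => hab (e ▸ rfl)
  have hnc : b.compl ≠ a := fun e => hab (e ▸ rfl)
  have hnc' : b.compl ≠ a.compl := fun e => hne (Lit.compl_injective e)
  have hbc : b ∉ G c := fun h' => hcd (hb.unique c ha.mem h')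
  refine ⟨Finset.mem_erase.2 ⟨hcd.symm, hb.mem⟩, ?_, ?_, ?_⟩
  · have := hb.lit_mem
    rw [mem_famDP]
    tauto
  · intro j hj hbj
    refine hb.unique j (Finset.mem_erase.1 hj).2 ?_
    rw [mem_famDP] at hbj
    tauto
  · obtain ⟨j, hj, hbj⟩ := hb.compl_mem
    by_cases hjc : j = c
    · subst hjc
      obtain ⟨i, hi, hai⟩ := ha.compl_mem
      refine ⟨i, Finset.mem_erase.2 ⟨?_, hi⟩, ?_⟩
      · rintro rfl
        exact h.clashFree i hi a ha.lit_mem hai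
      · rw [mem_famDP]
        tauto
    · refine ⟨j, Finset.mem_erase.2 ⟨hjc, hj⟩, ?_⟩
      rw [mem_famDP]
      tauto

end Bridge

/-! ### Invariants of singular DP-reduction on clause-sets -/

namespace ClauseSet

variable {V : Type*} [DecidableEq V] {F : ClauseSet V}

theorem vars_eq_famVars (F : ClauseSet V) : F.vars = famVars F id := rfl

theorem MinUnsat.singular_iff (h : F.MinUnsat) {v : V} :
    F.Singular v ↔ ∃ a c, a.1 = v ∧ FamSing F id a c := by
  simpa using (minUnsat_iff.1 h).singular_iff (v := v)

theorem MinUnsat.dp_eq (h : F.MinUnsat) {a : Lit V} {c : Clause V} (ha : FamSing F id a c) :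
    F.dp a.1 = (F.erase c).image (famDP id a c) := by
  simpa using (minUnsat_iff.1 h).dp_image ha

theorem MinUnsat.dp (h : F.MinUnsat) {v : V} (hv : F.Singular v) : (F.dp v).MinUnsat := by
  obtain ⟨a, c, rfl, ha⟩ := h.singular_iff.1 hv
  rw [h.dp_eq ha]
  exact ((minUnsat_iff.1 h).famMU_famDP ha).minUnsat

theorem MinUnsat.vars_dp (h : F.MinUnsat) {v : V} (hv : F.Singular v) :
    (F.dp v).vars = F.vars.erase v := by
  obtain ⟨a, c, rfl, ha⟩ := h.singular_iff.1 hv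
  rw [h.dp_eq ha, vars_image, vars_eq_famVars, (minUnsat_iff.1 h).famVars_famDP ha]

theorem MinUnsat.mem_vars (h : F.MinUnsat) {v : V} (hv : F.Singular v) : v ∈ F.vars := by
  obtain ⟨a, c, rfl, ha⟩ := h.singular_iff.1 hv
  exact fst_mem_famVars ha.mem ha.lit_mem

theorem MinUnsat.card_vars_dp (h : F.MinUnsat) {v : V} (hv : F.Singular v) :
    (F.dp v).vars.card + 1 = F.vars.card := by
  rw [h.vars_dp hv, Finset.card_erase_add_one (h.mem_vars hv)]

/-- One variable and one index disappear. No two resulting clauses coincide, since a minimally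
unsatisfiable family is injective. -/
theorem MinUnsat.deficiency_dp (h : F.MinUnsat) {v : V} (hv : F.Singular v) :
    (F.dp v).deficiency = F.deficiency := by
  have h1 := h.card_vars_dp hv
  obtain ⟨a, c, rfl, ha⟩ := h.singular_iff.1 hv
  have h2 : (F.dp a.1).card + 1 = F.card := by
    rw [h.dp_eq ha, Finset.card_image_of_injOn ((minUnsat_iff.1 h).famMU_famDP ha).injOn,
      Finset.card_erase_add_one ha.mem]
  unfold deficiency
  omega

theorem MinUnsat.sdpStep (h : F.MinUnsat) {v : V} (hv : F.Singular v) : SDPStep F (F.dp v) :=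
  ⟨h, h.dp hv, v, hv, rfl⟩

theorem mem_sDP_of_step {F' G : ClauseSet V} (h : SDPStep F F') (hG : G ∈ F'.sDP) : G ∈ F.sDP :=
  ⟨hG.1, hG.2.1, hG.2.2.head h⟩

theorem MinUnsat.sDP_nonempty (h : F.MinUnsat) : F.sDP.Nonempty := by
  induction hk : F.vars.card using Nat.strong_induction_on generalizing F with
  | _ k ih =>
    by_cases hns : F.Nonsingular
    · exact ⟨F, h, hns, Relation.ReflTransGen.refl⟩
    · simp only [Nonsingular, not_forall, not_not] at hns
      obtain ⟨v, hv⟩ := hns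
      obtain ⟨G, hG⟩ := ih _ (by have := h.card_vars_dp hv; omega) (h.dp hv) rfl
      exact ⟨G, mem_sDP_of_step (h.sdpStep hv) hG⟩

theorem MinUnsat.of_reduces {G : ClauseSet V} (h : F.MinUnsat) (hG : F.SDPReduces G) :
    G.MinUnsat ∧ G.deficiency = F.deficiency := by
  induction hG with
  | refl => exact ⟨h, rfl⟩
  | tail _ hs ih =>
    obtain ⟨h1, h2, v, hv, rfl⟩ := hs
    exact ⟨h2, (h1.deficiency_dp hv).trans ih.2⟩

/-- Singular variables with different main clauses can be reduced in any order. -/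
theorem MinUnsat.dp_comm (h : F.MinUnsat) {a b : Lit V} {c d : Clause V} (ha : FamSing F id a c)
    (hb : FamSing F id b d) (hcd : c ≠ d) (hab : a.1 ≠ b.1) :
    (F.dp a.1).Singular b.1 ∧ (F.dp b.1).Singular a.1 ∧
      (F.dp a.1).dp b.1 = (F.dp b.1).dp a.1 := by
  have h' := minUnsat_iff.1 h
  have hb' := h'.sing_famDP ha hb hcd hab
  have ha' := h'.sing_famDP hb ha hcd.symm hab.symm
  have hA := h'.famMU_famDP ha
  have hB := h'.famMU_famDP hb
  rw [h.dp_eq ha, h.dp_eq hb]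
  refine ⟨hA.singular_iff.2 ⟨b, d, rfl, hb'⟩, hB.singular_iff.2 ⟨a, c, rfl, ha'⟩, ?_⟩
  rw [hA.dp_image hb', hB.dp_image ha', Finset.erase_right_comm]
  refine Finset.image_congr fun i hi => ?_
  simp only [Finset.coe_erase, Set.mem_sdiff, Set.mem_singleton_iff, Finset.mem_coe] at hi
  exact h'.famDP_comm ha hb hcd hab hi.1.1 hi.2 hi.1.2

end ClauseSet

/-! ### Invariance of the number of remaining variables -/

/-- If two literals are singular with the same main clause and the complement of the first one
occurs at least twice, then the singular literals after reduction of the first one are singular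
already before, with another main clause. -/
theorem FamMU.sing_of_sing_famDP {V ι : Type*} [DecidableEq V] [DecidableEq ι] {s : Finset ι}
    {G : ι → Clause V} (h : FamMU s G) {a b y : Lit V} {c e : ι} (ha : FamSing s G a c)
    (hb : FamSing s G b c) (hab : a.1 ≠ b.1) (ha2 : 2 ≤ famDeg s G a.compl)
    (hb2 : 2 ≤ famDeg s G b.compl) (hy : FamSing (s.erase c) (famDP G a c) y e) :
    FamSing s G y e ∧ e ≠ c ∧ y.1 ≠ a.1 ∧ y.1 ≠ b.1 := by
  obtain ⟨hec, hes⟩ := Finset.mem_erase.1 hy.mem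
  have hya : y.1 ≠ a.1 := by
    have := fst_mem_famVars hy.mem hy.lit_mem
    rw [h.famVars_famDP ha] at this
    exact (Finset.mem_erase.1 this).1
  have hne : y ≠ a := fun e => hya (e ▸ rfl)
  have hne' : y ≠ a.compl := fun e => hya (e ▸ rfl)
  -- A literal of clause `c` other than `a` is copied into at least two resolvents, so it cannot be
  -- singular afterwards.
  have hyc : y ∉ G c := by
    intro hyc
    obtain ⟨i, hi, j, hj, hij, hai, haj⟩ := two_le_famDeg.1 ha2
    have key : ∀ i ∈ s, a.compl ∈ G i → i = e := by
      intro i hi hai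
      refine hy.unique i (Finset.mem_erase.2 ⟨?_, hi⟩) (mem_famDP.2 (Or.inl ⟨hai, Or.inl ⟨hyc, hne⟩⟩))
      rintro rfl
      exact h.clashFree _ hi a ha.lit_mem hai
    exact hij ((key i hi hai).trans (key j hj haj).symm)
  -- `b` lies in clause `c`, and `b.compl` keeps its at least two occurrences, which lie outside
  -- `c`.
  have hyb : y.1 ≠ b.1 := by
    intro e'
    rcases Lit.eq_or_eq_compl e' with rfl | rfl
    · exact hyc hb.lit_mem
    · obtain ⟨i, hi, j, hj, hij, hbi, hbj⟩ := two_le_famDeg.1 hb2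
      have key : ∀ i ∈ s, b.compl ∈ G i → i = e := by
        intro i hi hbi
        refine hy.unique i (Finset.mem_erase.2 ⟨?_, hi⟩) (by rw [mem_famDP]; tauto)
        rintro rfl
        exact h.clashFree _ hi b hb.lit_mem hbi
      exact hij ((key i hi hbi).trans (key j hj hbj).symm)
  refine ⟨⟨hes, ?_, ?_, ?_⟩, hec, hya, hyb⟩
  · have := hy.lit_mem
    rw [mem_famDP] at this
    tauto
  · intro j hj hyj
    refine hy.unique j (Finset.mem_erase.2 ⟨?_, hj⟩) (by rw [mem_famDP]; tauto)
    rintro rfl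
    exact hyc hyj
  · obtain ⟨j, hj, hyj⟩ := hy.compl_mem
    rw [mem_famDP] at hyj
    rcases hyj with ⟨-, ⟨hyj, -⟩ | ⟨hyj, -⟩⟩ | ⟨-, hyj⟩
    exacts [⟨c, ha.mem, hyj⟩, ⟨j, (Finset.mem_erase.1 hj).2, hyj⟩,
      ⟨j, (Finset.mem_erase.1 hj).2, hyj⟩]

namespace ClauseSet

variable {V : Type*} [DecidableEq V] {F : ClauseSet V}

/-- If a common main clause arises and the complement of one of the literals occurs only once, that
complement is singular too, with another main clause; exchanging the literal separates the main
clauses. -/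
theorem MinUnsat.distinct_or_common (h : F.MinUnsat) {v w : V} (hv : F.Singular v)
    (hw : F.Singular w) : (∃ a b c d, a.1 = v ∧ b.1 = w ∧ FamSing F id a c ∧ FamSing F id b d ∧
        c ≠ d) ∨
      ∃ a b c, a.1 = v ∧ b.1 = w ∧ FamSing F id a c ∧ FamSing F id b c ∧
        2 ≤ famDeg F id a.compl ∧ 2 ≤ famDeg F id b.compl := by
  obtain ⟨a, c, hav, ha⟩ := h.singular_iff.1 hv
  obtain ⟨b, d, hbw, hb⟩ := h.singular_iff.1 hw
  by_cases hcd : c = d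
  swap
  · exact Or.inl ⟨a, b, c, d, hav, hbw, ha, hb, hcd⟩
  subst hcd
  have key : ∀ a, FamSing F id a c → 2 ≤ famDeg F id a.compl ∨
      ∃ e, e ≠ c ∧ FamSing F id a.compl e := by
    intro a ha
    by_cases h2 : 2 ≤ famDeg F id a.compl
    · exact Or.inl h2
    · have h0 := famDeg_pos.2 ha.compl_mem
      obtain ⟨e, he, hae, hu⟩ := famDeg_eq_one.1 (show famDeg F id a.compl = 1 by omega)
      refine Or.inr ⟨e, ?_, he, hae, hu, c, ha.mem, by simpa using ha.lit_mem⟩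
      rintro rfl
      exact (minUnsat_iff.1 h).clashFree e he a ha.lit_mem hae
  rcases key a ha with ha2 | ⟨e, hec, he⟩
  · rcases key b hb with hb2 | ⟨e, hec, he⟩
    · exact Or.inr ⟨a, b, c, hav, hbw, ha, hb, ha2, hb2⟩
    · exact Or.inl ⟨a, b.compl, c, e, hav, hbw, ha, he, hec.symm⟩
  · exact Or.inl ⟨a.compl, b, e, c, hav, hbw, he, hb, hec⟩

/-- All results of complete singular DP-reduction have the same number of variables. -/
theorem MinUnsat.card_vars_eq (h : F.MinUnsat) {G G' : ClauseSet V} (hG : G ∈ F.sDP)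
    (hG' : G' ∈ F.sDP) : G.vars.card = G'.vars.card := by
  induction hk : F.vars.card using Nat.strong_induction_on generalizing F G G' with
  | _ k ih =>
    have ih' : ∀ {v : V}, F.Singular v → ∀ {A B : ClauseSet V}, A ∈ (F.dp v).sDP →
        B ∈ (F.dp v).sDP → A.vars.card = B.vars.card := fun {v} hv A B hA hB =>
      ih _ (by have := h.card_vars_dp hv; omega) (h.dp hv) hA hB rfl
    have first : ∀ {A : ClauseSet V}, A ∈ F.sDP → (F.Nonsingular ∧ A = F) ∨
        ∃ v, F.Singular v ∧ A ∈ (F.dp v).sDP := by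
      rintro A ⟨hA, hns, hr⟩
      rcases hr.cases_head with rfl | ⟨B, ⟨-, -, v, hv, rfl⟩, hr⟩
      · exact Or.inl ⟨hns, rfl⟩
      · exact Or.inr ⟨v, hv, hA, hns, hr⟩
    rcases first hG with ⟨hns, rfl⟩ | ⟨v, hv, hGv⟩
    · rcases first hG' with ⟨-, rfl⟩ | ⟨w, hw, -⟩
      · rfl
      · exact absurd hw (hns w)
    rcases first hG' with ⟨hns, rfl⟩ | ⟨w, hw, hGw⟩
    · exact absurd hv (hns v)
    by_cases hvw : v = w
    · subst hvw
      exact ih' hv hGv hGw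
    rcases h.distinct_or_common hv hw with
      ⟨a, b, c, d, rfl, rfl, ha, hb, hcd⟩ | ⟨a, b, c, rfl, rfl, ha, hb, ha2, hb2⟩
    · obtain ⟨hb', ha', hcomm⟩ := h.dp_comm ha hb hcd hvw
      obtain ⟨E, hE⟩ := ((h.dp hv).dp hb').sDP_nonempty
      exact (ih' hv hGv (mem_sDP_of_step ((h.dp hv).sdpStep hb') hE)).trans
        (ih' hw (mem_sDP_of_step ((h.dp hw).sdpStep ha') (hcomm ▸ hE)) hGw)
    -- After either reduction, the singular variables can be reduced first as well.
    have common : ∀ {a b : Lit V}, FamSing F id a c → FamSing F id b c → a.1 ≠ b.1 →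
        2 ≤ famDeg F id a.compl → 2 ≤ famDeg F id b.compl → ∀ x, (F.dp a.1).Singular x →
        F.Singular x ∧ (F.dp x).Singular a.1 ∧ (F.dp x).Singular b.1 ∧ (F.dp b.1).Singular x ∧
        (F.dp a.1).dp x = (F.dp x).dp a.1 ∧ (F.dp b.1).dp x = (F.dp x).dp b.1 := by
      intro a b ha hb hab ha2 hb2 x hx
      have h' := minUnsat_iff.1 h
      rw [h.dp_eq ha] at hx
      obtain ⟨y, e, rfl, hy⟩ := (h'.famMU_famDP ha).singular_iff.1 hx
      obtain ⟨hy', hec, hya, hyb⟩ := h'.sing_of_sing_famDP ha hb hab ha2 hb2 hy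
      obtain ⟨-, h1, h2⟩ := h.dp_comm ha hy' hec.symm hya.symm
      obtain ⟨h3, h4, h5⟩ := h.dp_comm hb hy' hec.symm hyb.symm
      exact ⟨h.singular_iff.2 ⟨y, e, rfl, hy'⟩, h1, h4, h3, h2, h5⟩
    -- Both sides are compared through results of reducing `x` first: the induction hypothesis is
    -- used for `F.dp a.1`, `F.dp b.1` and `F.dp x`.
    have finish : ∀ x, (F.dp a.1).Singular x → (F.dp b.1).Singular x → F.Singular x →
        (F.dp x).Singular a.1 → (F.dp x).Singular b.1 → (F.dp a.1).dp x = (F.dp x).dp a.1 →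
        (F.dp b.1).dp x = (F.dp x).dp b.1 → G.vars.card = G'.vars.card := by
      intro x hxa hxb hx hax hbx ea eb
      obtain ⟨A, hA⟩ := ((h.dp hv).dp hxa).sDP_nonempty
      obtain ⟨B, hB⟩ := ((h.dp hw).dp hxb).sDP_nonempty
      have e1 := ih' hv hGv (mem_sDP_of_step ((h.dp hv).sdpStep hxa) hA)
      have e2 := ih' hw hGw (mem_sDP_of_step ((h.dp hw).sdpStep hxb) hB)
      rw [ea] at hA
      rw [eb] at hB
      have e3 := ih' hx (mem_sDP_of_step ((h.dp hx).sdpStep hax) hA)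
        (mem_sDP_of_step ((h.dp hx).sdpStep hbx) hB)
      omega
    by_cases hA : ∃ x, (F.dp a.1).Singular x
    · obtain ⟨x, hx⟩ := hA
      obtain ⟨h1, h2, h3, h4, h5, h6⟩ := common ha hb hvw ha2 hb2 x hx
      exact finish x hx h4 h1 h2 h3 h5 h6
    by_cases hB : ∃ x, (F.dp b.1).Singular x
    · obtain ⟨x, hx⟩ := hB
      obtain ⟨h1, h2, h3, h4, h5, h6⟩ := common hb ha (Ne.symm hvw) hb2 ha2 x hx
      exact finish x h4 hx h1 h3 h2 h6 h5
    -- Both reductions are now nonsingular, hence final, and each has lost exactly one variable.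
    -- They need not be equal.
    push Not at hA hB
    have final : ∀ {A B : ClauseSet V}, (∀ x, ¬ B.Singular x) → A ∈ B.sDP → A = B := by
      rintro A B hB ⟨-, -, hr⟩
      rcases hr.cases_head with rfl | ⟨C, ⟨-, -, v, hv, rfl⟩, hr⟩
      · rfl
      · exact absurd hv (hB v)
    rw [final hA hGv, final hB hGw]
    have := h.card_vars_dp hv
    have := h.card_vars_dp hw
    omega

end ClauseSet

/-! ### Saturation, restriction, and bounds by the deficiency -/

section Saturation

variable {V ι : Type*} [DecidableEq V]

/-- No literal over the variables of the family can be added to a clause without making the family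
satisfiable. -/
def FamSaturated (s : Finset ι) (G : ι → Clause V) : Prop :=
  ∀ i ∈ s, ∀ y : Lit V, y.1 ∈ famVars s G → y ∉ G i → y.compl ∉ G i → ∃ f : V → Bool,
    y.Holds f ∧ ∀ j ∈ s, j ≠ i → ∃ z ∈ G j, z.Holds f

/-- The index set after assigning the value true to the literal `y`. -/
def restIndex (s : Finset ι) (G : ι → Clause V) (y : Lit V) : Finset ι := s.filter fun i => y ∉ G i

/-- The clauses after assigning the value true to the literal `y`. -/
def restFam (G : ι → Clause V) (y : Lit V) : ι → Clause V := fun i => (G i).erase y.compl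

/-- The number of clauses in which the variable `v` occurs. -/
def famOcc (s : Finset ι) (G : ι → Clause V) (v : V) : ℕ :=
  (s.filter fun i => v ∈ (G i).vars).card

variable {s : Finset ι} {G : ι → Clause V}

theorem mem_restIndex {y : Lit V} {i : ι} : i ∈ restIndex s G y ↔ i ∈ s ∧ y ∉ G i := by
  simp [restIndex]

theorem mem_restFam {y z : Lit V} {i : ι} : z ∈ restFam G y i ↔ z ≠ y.compl ∧ z ∈ G i := by
  simp [restFam]

theorem card_restIndex_add (s : Finset ι) (G : ι → Clause V) (y : Lit V) :
    (restIndex s G y).card + famDeg s G y = s.card := by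
  rw [add_comm]
  exact Finset.card_filter_add_card_filter_not _

/-- A failure of saturation says that no assignment making `y` true satisfies all clauses but `i`;
so adding `y` to clause `i` keeps the family unsatisfiable. The number of missing literals
decreases. -/
theorem FamMU.exists_saturated [DecidableEq ι] (h : FamMU s G) : ∃ G' : ι → Clause V,
    (∀ i, G i ⊆ G' i) ∧ FamMU s G' ∧ famVars s G' = famVars s G ∧ FamSaturated s G' := by
  induction hk : ∑ i ∈ s, ((famVars s G ×ˢ Finset.univ) \ G i).card using
    Nat.strong_induction_on generalizing G with
  | _ k ih =>
    by_cases hs : FamSaturated s G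
    · exact ⟨G, fun _ => subset_rfl, h, rfl, hs⟩
    · unfold FamSaturated at hs
      push Not at hs
      obtain ⟨i, hi, y, hyv, hyi, hyi', hf⟩ := hs
      set H := Function.update G i (insert y (G i)) with hH
      have hHi : H i = insert y (G i) := by simp [hH]
      have hHj : ∀ j, j ≠ i → H j = G j := fun j hj => by simp [hH, hj]
      have hle : ∀ j, G j ⊆ H j := by
        intro j
        by_cases e : j = i
        · subst e; rw [hHi]; exact Finset.subset_insert _ _
        · rw [hHj j e]
      have hvars : famVars s H = famVars s G := by
        ext v
        simp only [mem_famVars]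
        constructor
        · rintro ⟨j, hj, z, hz, rfl⟩
          by_cases e : j = i
          · subst e
            rw [hHi, Finset.mem_insert] at hz
            rcases hz with rfl | hz
            · exact mem_famVars.1 hyv
            · exact ⟨j, hj, z, hz, rfl⟩
          · exact ⟨j, hj, z, hHj j e ▸ hz, rfl⟩
        · rintro ⟨j, hj, z, hz, e⟩
          exact ⟨j, hj, z, hle j hz, e⟩
      have hMU : FamMU s H := by
        refine ⟨?_, ?_, ?_⟩
        · intro j hj z hz hz'
          by_cases e : j = i
          · subst e
            rw [hHi, Finset.mem_insert] at hz hz'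
            rcases hz with rfl | hz <;> rcases hz' with hz' | hz'
            · exact Lit.compl_ne _ hz'
            · exact hyi' hz'
            · subst hz'
              exact hyi' (by simpa using hz)
            · exact h.clashFree j hj z hz hz'
          · rw [hHj j e] at hz hz'
            exact h.clashFree j hj z hz hz'
        · intro f
          by_contra! hc
          have hG : ∀ j ∈ s, j ≠ i → ∃ z ∈ G j, z.Holds f := fun j hj e => hHj j e ▸ hc j hj
          obtain ⟨z, hz, hzf⟩ := hc i hi
          rw [hHi, Finset.mem_insert] at hz
          rcases hz with rfl | hz
          · obtain ⟨j, hj, hji, hj'⟩ := hf f hzf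
            obtain ⟨x, hx, hxf⟩ := hG j hj hji
            exact hj' x hx hxf
          · obtain ⟨j, hj, hj'⟩ := h.unsat f
            by_cases e : j = i
            · subst e
              exact hj' z hz hzf
            · obtain ⟨x, hx, hxf⟩ := hG j hj e
              exact hj' x hx hxf
        · intro j hj
          obtain ⟨f, hf⟩ := h.critical j hj
          exact ⟨f, fun l hl hlj => (hf l hl hlj).imp fun z hz => ⟨hle l hz.1, hz.2⟩⟩
      obtain ⟨G', h1, h2, h3, h4⟩ := ih _ (by
        rw [← hk, hvars]
        refine Finset.sum_lt_sum (fun j _ => Finset.card_le_card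
          (Finset.sdiff_subset_sdiff subset_rfl (hle j))) ⟨i, hi, Finset.card_lt_card ?_⟩
        refine Finset.ssubset_iff_subset_ne.2
          ⟨Finset.sdiff_subset_sdiff subset_rfl (hle i), fun e => ?_⟩
        have := Finset.ext_iff.1 e y
        simp [hHi, hyv, hyi] at this) hMU rfl
      exact ⟨G', fun j => (hle j).trans (h1 j), h2, h3.trans hvars, h4⟩

/-- Criticality of a surviving clause needs an assignment that makes `y` true. If the clause
contains `y.compl`, every critical assignment falsifying it does; otherwise saturation supplies one.
-/
theorem FamMU.rest (h : FamMU s G) (hs : FamSaturated s G) {y : Lit V}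
    (hy : y.1 ∈ famVars s G) : FamMU (restIndex s G y) (restFam G y) := by
  refine ⟨?_, ?_, ?_⟩
  · intro i hi z hz hz'
    exact h.clashFree i (mem_restIndex.1 hi).1 z (mem_restFam.1 hz).2 (mem_restFam.1 hz').2
  · intro f
    obtain ⟨i, hi, hf⟩ := h.unsat (Function.update f y.1 y.2)
    refine ⟨i, mem_restIndex.2 ⟨hi, fun hyi => hf y hyi (Lit.holds_update_self f y)⟩, ?_⟩
    intro z hz hzf
    rw [mem_restFam] at hz
    exact hf z hz.2 (hzf.update hz.1)
  · intro i hi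
    rw [mem_restIndex] at hi
    have : ∃ f : V → Bool, y.Holds f ∧ ∀ j ∈ s, j ≠ i → ∃ z ∈ G j, z.Holds f := by
      by_cases hyi : y.compl ∈ G i
      · obtain ⟨f, hf, hf'⟩ := h.exists_critical hi.1
        have := hf' _ hyi
        rw [Lit.holds_compl, not_not] at this
        exact ⟨f, this, hf⟩
      · exact hs i hi.1 y hy hi.2 hyi
    obtain ⟨f, hyf, hf⟩ := this
    refine ⟨f, fun j hj hji => ?_⟩
    obtain ⟨z, hz, hzf⟩ := hf j (mem_restIndex.1 hj).1 hji
    refine ⟨z, mem_restFam.2 ⟨?_, hz⟩, hzf⟩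
    rintro rfl
    exact Lit.holds_compl.1 hzf hyf

/-- A further vanishing variable would occur only in clauses containing `y`. As `y.compl` occurs
elsewhere, it would have fewer occurrences than `y.1`, against minimality. -/
theorem FamMU.famVars_rest (h : FamMU s G) {y : Lit V} (hy : y.1 ∈ famVars s G)
    (hmin : ∀ w ∈ famVars s G, famOcc s G y.1 ≤ famOcc s G w) :
    famVars (restIndex s G y) (restFam G y) = (famVars s G).erase y.1 := by
  ext w
  rw [Finset.mem_erase]
  constructor
  · intro hw
    obtain ⟨i, hi, z, hz, rfl⟩ := mem_famVars.1 hw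
    rw [mem_restIndex] at hi
    rw [mem_restFam] at hz
    refine ⟨fun e => ?_, fst_mem_famVars hi.1 hz.2⟩
    rcases Lit.eq_or_eq_compl e with rfl | rfl
    · exact hi.2 hz.2
    · exact hz.1 rfl
  · rintro ⟨hwy, hw⟩
    by_contra hc
    have hsub : ∀ i ∈ s, w ∈ (G i).vars → y ∈ G i := by
      intro i hi hwi
      obtain ⟨z, hz, rfl⟩ := Clause.mem_vars.1 hwi
      by_contra hyi
      exact hc (fst_mem_famVars (mem_restIndex.2 ⟨hi, hyi⟩)
        (mem_restFam.2 ⟨fun e => hwy (e ▸ rfl), hz⟩))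
    obtain ⟨i, hi, hyi⟩ := h.exists_mem_of_fst_mem (y := y.compl) hy
    refine absurd (hmin w hw) (not_le.2 (Finset.card_lt_card ?_))
    refine Finset.ssubset_iff_subset_ne.2 ⟨?_, fun e => ?_⟩
    · intro j hj
      rw [Finset.mem_filter] at hj ⊢
      exact ⟨hj.1, Clause.mem_vars.2 ⟨y, hsub j hj.1 hj.2, rfl⟩⟩
    · have := Finset.ext_iff.1 e i
      simp only [Finset.mem_filter, hi, true_and] at this
      exact h.clashFree i hi y (hsub i hi (this.2 (Clause.mem_vars.2 ⟨_, hyi, rfl⟩))) hyi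

theorem exists_min_famOcc (hne : (famVars s G).Nonempty) :
    ∃ v ∈ famVars s G, ∀ w ∈ famVars s G, famOcc s G v ≤ famOcc s G w :=
  Finset.exists_min_image _ _ hne

/-- Minimally unsatisfiable families have more clauses than variables. -/
theorem FamMU.card_famVars_lt [DecidableEq ι] (h : FamMU s G) : (famVars s G).card < s.card := by
  induction hk : (famVars s G).card using Nat.strong_induction_on generalizing s G with
  | _ k ih =>
    rcases (famVars s G).eq_empty_or_nonempty with he | hne
    · obtain ⟨i, hi, -⟩ := h.unsat fun _ => true
      rw [← hk, he]
      exact Finset.card_pos.2 ⟨i, hi⟩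
    -- The restriction loses exactly one variable but at least one clause.
    · obtain ⟨G', -, h', hv, hs⟩ := h.exists_saturated
      rw [← hv] at hne hk
      obtain ⟨v, hv, hmin⟩ := exists_min_famOcc hne
      have h1 := h'.rest hs (y := (v, true)) hv
      have h2 : _ = (famVars s G').erase v := h'.famVars_rest (y := (v, true)) hv hmin
      have h3 := Finset.card_erase_add_one hv
      have h4 := ih _ (by rw [h2]; omega) h1 rfl
      have h5 := famDeg_pos.2 (h'.exists_mem_of_fst_mem (y := (v, true)) hv)
      have h6 := card_restIndex_add s G' (v, true)
      rw [h2] at h4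
      omega

/-- In a saturated minimally unsatisfiable family, the literals of a variable occurring in the
smallest possible number of clauses have degree at most the deficiency. -/
theorem FamMU.famDeg_add_card_le [DecidableEq ι] (h : FamMU s G) (hs : FamSaturated s G)
    {y : Lit V} (hy : y.1 ∈ famVars s G)
    (hmin : ∀ w ∈ famVars s G, famOcc s G y.1 ≤ famOcc s G w) :
    famDeg s G y + (famVars s G).card ≤ s.card := by
  have h1 := (h.rest hs hy).card_famVars_lt
  rw [h.famVars_rest hy hmin] at h1
  have h3 := Finset.card_erase_add_one hy
  have h6 := card_restIndex_add s G y
  omega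

theorem famDeg_mono {H : ι → Clause V} (hle : ∀ i ∈ s, G i ⊆ H i) (y : Lit V) :
    famDeg s G y ≤ famDeg s H y := by
  refine Finset.card_le_card fun i hi => ?_
  rw [Finset.mem_filter] at hi ⊢
  exact ⟨hi.1, hle i hi.1 hi.2⟩

/-- In case of deficiency one there is a variable both of whose literals occur exactly once. -/
theorem FamMU.exists_famDeg_eq_one [DecidableEq ι] (h : FamMU s G)
    (hd : s.card = (famVars s G).card + 1) (hne : (famVars s G).Nonempty) :
    ∃ v ∈ famVars s G, ∀ y : Lit V, y.1 = v → famDeg s G y = 1 := by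
  obtain ⟨G', hle, h', hv, hs⟩ := h.exists_saturated
  rw [← hv] at hne
  obtain ⟨v, hv', hmin⟩ := exists_min_famOcc hne
  refine ⟨v, hv ▸ hv', ?_⟩
  rintro y rfl
  -- The degree is at most 1 in the saturation, hence in `G`, where it is also positive.
  have h1 := h'.famDeg_add_card_le hs hv' hmin
  have h2 := famDeg_pos.2 (h.exists_mem_of_fst_mem (hv ▸ hv'))
  have h3 := famDeg_mono (fun i (_ : i ∈ s) => hle i) y
  rw [hv] at h1
  omega

end Saturation

/-! ### Deficiency one: clashes and chains -/

section DeficiencyOne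

variable {V ι : Type*} [DecidableEq V] [DecidableEq ι] {s : Finset ι} {G : ι → Clause V}

theorem FamMU.card_famVars_famDP (h : FamMU s G) {a : Lit V} {c : ι} (ha : FamSing s G a c) :
    (famVars (s.erase c) (famDP G a c)).card + 1 = (famVars s G).card := by
  rw [h.famVars_famDP ha, Finset.card_erase_add_one (fst_mem_famVars ha.mem ha.lit_mem)]

omit [DecidableEq V] [DecidableEq ι] in
theorem FamMU.ne_of_compl_mem (h : FamMU s G) {i j : ι} {y : Lit V} (hi : i ∈ s) (hy : y ∈ G i)
    (hy' : y.compl ∈ G j) : i ≠ j := by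
  rintro rfl
  exact h.clashFree i hi y hy hy'

/-- In deficiency one, two clauses clash in at most one variable. -/
theorem FamMU.eq_of_clash (h : FamMU s G) (hd : s.card = (famVars s G).card + 1) {i j : ι}
    (hi : i ∈ s) (hj : j ∈ s) {y z : Lit V} (hy : y ∈ G i) (hy' : y.compl ∈ G j) (hz : z ∈ G i)
    (hz' : z.compl ∈ G j) : y = z := by
  induction hk : (famVars s G).card using Nat.strong_induction_on generalizing s G i j y z with
  | _ k ih =>
    obtain ⟨v, -, hv⟩ := h.exists_famDeg_eq_one hd ⟨_, fst_mem_famVars hi hy⟩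
    set a : Lit V := (v, true) with ha
    obtain ⟨c, hc, hac, hcu⟩ := famDeg_eq_one.1 (hv a rfl)
    obtain ⟨d, hds, had, hdu⟩ := famDeg_eq_one.1 (hv a.compl rfl)
    have hsing : FamSing s G a c := ⟨hc, hac, hcu, d, hds, had⟩
    have hcard := h.card_famVars_famDP hsing
    have hs' := Finset.card_erase_add_one hc
    have ih' : ∀ {i j : ι}, i ∈ s → j ∈ s → i ≠ c → j ≠ c → ∀ {y z : Lit V}, y ∈ famDP G a c i →
        y.compl ∈ famDP G a c j → z ∈ famDP G a c i → z.compl ∈ famDP G a c j → y = z :=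
      fun hi hj hic hjc _ _ h1 h2 h3 h4 => ih _ (by omega) (h.famMU_famDP hsing) (by omega)
        (Finset.mem_erase.2 ⟨hic, hi⟩) (Finset.mem_erase.2 ⟨hjc, hj⟩) h1 h2 h3 h4 rfl
    -- Clashes with the main clause `c`: with `d` it clashes in `a` alone. The resolvent stored at
    -- `d` inherits the clashes of `c` with any other clause, so the induction hypothesis applies to
    -- `d` and `j`.
    have main : ∀ {j : ι} {y z : Lit V}, j ∈ s → y ∈ G c → y.compl ∈ G j → z ∈ G c →
        z.compl ∈ G j → y = z := by
      intro j y z hj hy hy' hz hz'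
      have hjc : j ≠ c := (h.ne_of_compl_mem hc hy hy').symm
      by_cases hjd : j = d
      · subst hjd
        have : ∀ {y}, y ∈ G c → y.compl ∈ G j → y = a := by
          intro y hy hy'
          by_contra hya
          exact h.compl_notMem_of_sing hsing hj had hy hya hy'
        rw [this hy hy', this hz hz']
      · have haj : a.compl ∉ G j := fun h' => hjd (hdu j hj h')
        have hcd : d ≠ c := (h.ne_of_compl_mem hc hac had).symm
        refine ih' hds hj hcd hjc ?_ ?_ ?_ ?_ <;> rw [mem_famDP]
        · exact Or.inl ⟨had, Or.inl ⟨hy, fun e => haj (e ▸ hy')⟩⟩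
        · exact Or.inr ⟨haj, hy'⟩
        · exact Or.inl ⟨had, Or.inl ⟨hz, fun e => haj (e ▸ hz')⟩⟩
        · exact Or.inr ⟨haj, hz'⟩
    by_cases hic : i = c
    · subst hic
      exact main hj hy hy' hz hz'
    by_cases hjc : j = c
    · subst hjc
      exact Lit.compl_injective (main hi hy' (by simpa using hy) hz' (by simpa using hz))
    have hai : a ∉ G i := fun h' => hic (hcu i hi h')
    have haj : a ∉ G j := fun h' => hjc (hcu j hj h')
    have key : ∀ {y}, y ∈ G i → y.compl ∈ G j → y ∈ famDP G a c i ∧ y.compl ∈ famDP G a c j := by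
      intro y hy hy'
      have h1 : y ≠ a.compl := by
        rintro rfl
        exact haj (by simpa using hy')
      have h2 : y.compl ≠ a.compl := by
        intro e
        exact hai (Lit.compl_injective e ▸ hy)
      simp only [mem_famDP]
      tauto
    exact ih' hi hj hic hjc (key hy hy').1 (key hy hy').2 (key hz hz').1 (key hz hz').2

/-- The family is linearly ordered with last clause `S`: the literal `x i` occurs first in the
clause with index `L i`, and all later clauses contain it at most negatively. -/
structure FamChain {V ι : Type*} [DecidableEq V] (s : Finset ι) (G : ι → Clause V) (S : ι) (m : ℕ)
    (x : ℕ → Lit V) (L : ℕ → ι) : Prop where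
  mem : ∀ i < m, L i ∈ s
  ne_last : ∀ i < m, L i ≠ S
  surj : ∀ k ∈ s, k = S ∨ ∃ i < m, L i = k
  lit_mem : ∀ i < m, x i ∈ G (L i)
  eq_of_mem : ∀ i < m, ∀ y ∈ G (L i), y = x i ∨ ∃ j < i, y = (x j).compl
  eq_of_mem_last : ∀ y ∈ G S, ∃ j < m, y = (x j).compl
  var_inj : ∀ i < m, ∀ j < m, (x i).1 = (x j).1 → i = j
  vars : ∀ v, v ∈ famVars s G ↔ ∃ i < m, (x i).1 = v

/-- In deficiency one, if some clause contains all variables occurring only twice, then the family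
is a chain ending in this clause. -/
theorem FamMU.exists_famChain (h : FamMU s G) (hd : s.card = (famVars s G).card + 1) {S : ι}
    (hS : S ∈ s) (hvS : ∀ v ∈ famVars s G, (∀ y : Lit V, y.1 = v → famDeg s G y = 1) →
      v ∈ (G S).vars) (y₀ : Lit V) : ∃ x L, FamChain s G S (famVars s G).card x L := by
  induction hk : (famVars s G).card generalizing s G with
  | zero =>
    have hempty : famVars s G = ∅ := Finset.card_eq_zero.1 hk
    have hno : ∀ i ∈ s, ∀ y, y ∉ G i := by
      intro i hi y hy
      have := fst_mem_famVars hi hy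
      simp [hempty] at this
    -- The chain is empty; `y₀` only provides a literal to define the sequence.
    refine ⟨fun _ => y₀, fun _ => S, by simp, by simp, ?_, by simp, by simp, ?_, by simp, ?_⟩
    · intro k hkS
      left
      rw [hk] at hd
      exact Finset.card_le_one.1 (by omega) k hkS S hS
    · intro y hy
      exact absurd hy (hno S hS y)
    · simp [hempty]
  | succ k ih =>
    obtain ⟨v, hv, hv1⟩ := h.exists_famDeg_eq_one hd (Finset.card_pos.1 (by omega))
    obtain ⟨z, hz, rfl⟩ := Clause.mem_vars.1 (hvS v hv hv1)
    obtain ⟨P, hP, hzP, hPu⟩ := famDeg_eq_one.1 (hv1 z.compl rfl)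
    obtain ⟨S', hS', hzS', hSu⟩ := famDeg_eq_one.1 (hv1 z rfl)
    obtain rfl := hSu S hS hz
    have hPS : P ≠ S := (h.ne_of_compl_mem hS hz hzP).symm
    -- `S` and `P` are the only clauses containing the variable of `z`. They are merged into the
    -- last clause of a shorter chain, to which `P` is then appended just before `S`.
    have hsing : FamSing s G z.compl P := ⟨hP, hzP, hPu, S, hS, by simpa using hz⟩
    have hcard := h.card_famVars_famDP hsing
    have hs' := Finset.card_erase_add_one hP
    have hvars := h.famVars_famDP hsing
    have hother : ∀ i ∈ s, i ≠ S → famDP G z.compl P i = G i := by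
      intro i hi hiS
      have : z ∉ G i := fun h' => hiS (hSu i hi h')
      simp [famDP, this]
    have hSmem : ∀ y, y ∈ famDP G z.compl P S ↔ (y ∈ G P ∧ y ≠ z.compl) ∨ (y ∈ G S ∧ y ≠ z) := by
      intro y
      rw [mem_famDP]
      simp [hz]
    obtain ⟨x, L, hc⟩ := ih (h.famMU_famDP hsing) (by omega) (Finset.mem_erase.2 ⟨hPS.symm, hS⟩) (by
      -- If `w` is missing from the resolvent, it is missing from both `P` and `S`; so it has the
      -- same occurrences before the reduction, and the hypothesis puts it into `S`.
      intro w hw hw1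
      by_contra hwS
      rw [hvars, Finset.mem_erase] at hw
      have hwP : ∀ y : Lit V, y.1 = w → y ∉ G P ∧ y ∉ G S := by
        intro y hyw
        have h1 : y ∉ famDP G z.compl P S := fun h' => hwS (Clause.mem_vars.2 ⟨y, h', hyw⟩)
        rw [hSmem] at h1
        have h2 : y ≠ z := fun e => hw.1 (by rw [← hyw, e]; rfl)
        have h3 : y ≠ z.compl := fun e => hw.1 (by rw [← hyw, e])
        tauto
      have hwS' := hvS w hw.2 (by
        intro y hyw
        obtain ⟨i, hi, hyi, hiu⟩ := famDeg_eq_one.1 (hw1 y hyw)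
        rw [Finset.mem_erase] at hi
        have hiS : i ≠ S := by
          rintro rfl
          exact hwS (Clause.mem_vars.2 ⟨y, hyi, hyw⟩)
        rw [hother i hi.2 hiS] at hyi
        refine famDeg_eq_one.2 ⟨i, hi.2, hyi, fun j hj hyj => ?_⟩
        have hjP : j ≠ P := by
          rintro rfl
          exact (hwP y hyw).1 hyj
        have hjS : j ≠ S := by
          rintro rfl
          exact (hwP y hyw).2 hyj
        exact hiu j (Finset.mem_erase.2 ⟨hjP, hj⟩) (by rwa [hother j hj hjS]))
      obtain ⟨y, hy, hyw⟩ := Clause.mem_vars.1 hwS'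
      exact (hwP y hyw).2 hy) (by omega)
    have hxz : ∀ i < k, (x i).1 ≠ z.1 := by
      intro i hi
      have := (hc.vars _).2 ⟨i, hi, rfl⟩
      rw [hvars] at this
      exact (Finset.mem_erase.1 this).1
    have hcase : ∀ i < k + 1, i < k ∨ i = k := fun i hi => by omega
    have hL : ∀ i < k, L i ∈ s ∧ L i ≠ P := fun i hi => by
      have := Finset.mem_erase.1 (hc.mem i hi)
      exact ⟨this.2, this.1⟩
    refine ⟨fun i => if i < k then x i else z.compl, fun i => if i < k then L i else P,
      ?_, ?_, ?_, ?_, ?_, ?_, ?_, ?_⟩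
    · intro i hi
      rcases hcase i hi with hi | rfl
      · simpa [hi] using (hL i hi).1
      · simpa using hP
    · intro i hi
      rcases hcase i hi with hi | rfl
      · simpa [hi] using hc.ne_last i hi
      · simpa using hPS
    · intro j hj
      by_cases hjP : j = P
      · exact Or.inr ⟨k, by omega, by simp [hjP]⟩
      · rcases hc.surj j (Finset.mem_erase.2 ⟨hjP, hj⟩) with e | ⟨i, hi, e⟩
        · exact Or.inl e
        · exact Or.inr ⟨i, by omega, by simp [hi, e]⟩
    · intro i hi
      rcases hcase i hi with hi | rfl
      · have := hc.lit_mem i hi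
        rw [hother _ (hL i hi).1 (hc.ne_last i hi)] at this
        simpa [hi] using this
      · simpa using hzP
    · intro i hi y hy
      rcases hcase i hi with hi | rfl
      · simp only [hi, if_true] at hy ⊢
        rw [← hother _ (hL i hi).1 (hc.ne_last i hi)] at hy
        rcases hc.eq_of_mem i hi y hy with e | ⟨j, hj, e⟩
        · exact Or.inl e
        · exact Or.inr ⟨j, hj, by simp [hj.trans hi, e]⟩
      · simp only [lt_irrefl, if_false] at hy ⊢
        by_cases hyz : y = z.compl
        · exact Or.inl hyz
        · obtain ⟨j, hj, e⟩ := hc.eq_of_mem_last y ((hSmem y).2 (Or.inl ⟨hy, hyz⟩))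
          exact Or.inr ⟨j, hj, by simp [hj, e]⟩
    · intro y hy
      by_cases hyz : y = z
      · exact ⟨k, by omega, by simp [hyz]⟩
      · obtain ⟨j, hj, e⟩ := hc.eq_of_mem_last y ((hSmem y).2 (Or.inr ⟨hy, hyz⟩))
        exact ⟨j, by omega, by simp [hj, e]⟩
    · intro i hi j hj e
      rcases hcase i hi with hi | rfl <;> rcases hcase j hj with hj | rfl
      · simp only [hi, hj, if_true] at e
        exact hc.var_inj i hi j hj e
      · simp only [hi, if_true, lt_irrefl, if_false] at e
        exact absurd e (hxz i hi)
      · simp only [hj, if_true, lt_irrefl, if_false] at e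
        exact absurd e.symm (hxz j hj)
      · rfl
    · intro w
      by_cases hwz : w = z.1
      · subst hwz
        exact iff_of_true hv ⟨k, by omega, by simp⟩
      · have : w ∈ famVars s G ↔ w ∈ famVars (s.erase P) (famDP G z.compl P) := by
          rw [hvars, Finset.mem_erase]
          exact ⟨fun h' => ⟨hwz, h'⟩, fun h' => h'.2⟩
        rw [this, hc.vars]
        constructor
        · rintro ⟨i, hi, e⟩
          exact ⟨i, by omega, by simp [hi, e]⟩
        · rintro ⟨i, hi, e⟩
          rcases hcase i hi with hi | rfl
          · exact ⟨i, hi, by simpa [hi] using e⟩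
          · simp at e
            exact absurd e.symm hwz

namespace FamChain

variable {S : ι} {m : ℕ} {x : ℕ → Lit V} {L : ℕ → ι}

omit [DecidableEq ι]

theorem eq_of_lit_mem (hc : FamChain s G S m x L) {i : ℕ} (hi : i < m) {k : ι} (hk : k ∈ s)
    (hx : x i ∈ G k) : k = L i := by
  rcases hc.surj k hk with rfl | ⟨j, hj, rfl⟩
  · obtain ⟨l, hl, e⟩ := hc.eq_of_mem_last _ hx
    obtain rfl := hc.var_inj i hi l hl (by rw [e]; rfl)
    exact absurd e.symm (Lit.compl_ne _)
  · rcases hc.eq_of_mem j hj _ hx with e | ⟨l, hl, e⟩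
    · rw [hc.var_inj i hi j hj (by rw [e])]
    · obtain rfl := hc.var_inj i hi l (hl.trans hj) (by rw [e]; rfl)
      exact absurd e.symm (Lit.compl_ne _)

theorem famDeg_lit (hc : FamChain s G S m x L) {i : ℕ} (hi : i < m) : famDeg s G (x i) = 1 :=
  famDeg_eq_one.2 ⟨L i, hc.mem i hi, hc.lit_mem i hi, fun _ hj hx => hc.eq_of_lit_mem hi hj hx⟩

theorem lt_of_compl_mem (hc : FamChain s G S m x L) {i j : ℕ} (hi : i < m) (hj : j < m)
    (hx : (x j).compl ∈ G (L i)) : j < i := by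
  rcases hc.eq_of_mem i hi _ hx with e | ⟨l, hl, e⟩
  · obtain rfl := hc.var_inj j hj i hi (by rw [← e]; rfl)
    exact absurd e (Lit.compl_ne _)
  · rwa [hc.var_inj j hj l (hl.trans hi) (by rw [Lit.compl_injective e])]

theorem inj (hc : FamChain s G S m x L) {i j : ℕ} (hi : i < m) (hj : j < m) (e : L i = L j) :
    i = j := by
  have h1 := hc.lit_mem i hi
  rw [e] at h1
  rcases hc.eq_of_mem j hj _ h1 with e | ⟨l, hl, e⟩
  · exact hc.var_inj i hi j hj (by rw [e])
  · obtain rfl := hc.var_inj i hi l (hl.trans hj) (by rw [e]; rfl)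
    exact absurd e.symm (Lit.compl_ne _)

end FamChain

end DeficiencyOne

/-! ### Deficiency two: splitting on a variable with two occurrences of each sign -/

section DeficiencyTwo

variable {V ι : Type*} [DecidableEq V] {s : Finset ι} {G : ι → Clause V}

/-- If a literal occurring at least twice occurs only once after setting `y` to true, then it occurs
together with `y` in some clause. -/
theorem exists_mem_of_famDeg_rest {y z : Lit V} (hz : 2 ≤ famDeg s G z) (hne : z ≠ y.compl)
    (h1 : famDeg (restIndex s G y) (restFam G y) z = 1) : ∃ i ∈ s, y ∈ G i ∧ z ∈ G i := by
  by_contra! hc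
  obtain ⟨i, hi, j, hj, hij, hzi, hzj⟩ := two_le_famDeg.1 hz
  obtain ⟨k, -, -, hk⟩ := famDeg_eq_one.1 h1
  have key : ∀ i ∈ s, z ∈ G i → i = k := fun i hi hzi =>
    hk i (mem_restIndex.2 ⟨hi, fun hy => hc i hi hy hzi⟩) (mem_restFam.2 ⟨hne, hzi⟩)
  exact hij ((key i hi hzi).trans (key j hj hzj).symm)

theorem fst_ne_of_mem_famVars_rest {y : Lit V} {w : V}
    (hw : w ∈ famVars (restIndex s G y) (restFam G y)) : w ≠ y.1 := by
  obtain ⟨i, hi, z, hz, rfl⟩ := mem_famVars.1 hw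
  rw [mem_restIndex] at hi
  rw [mem_restFam] at hz
  intro e
  rcases Lit.eq_or_eq_compl e with rfl | rfl
  · exact hi.2 hz.2
  · exact hz.1 rfl

/-- A variable of a nonsingular saturated minimally unsatisfiable family of deficiency two with two
positive and two negative occurrences. -/
structure FamSplit (s : Finset ι) (G : ι → Clause V) (y : Lit V) : Prop where
  famMU : FamMU s G
  two_le : ∀ z : Lit V, z.1 ∈ famVars s G → 2 ≤ famDeg s G z
  mem_vars : y.1 ∈ famVars s G
  deg : famDeg s G y = 2
  rest : ∀ z : Lit V, z.1 = y.1 → FamMU (restIndex s G z) (restFam G z)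
  vars_rest : ∀ z : Lit V, z.1 = y.1 →
    famVars (restIndex s G z) (restFam G z) = (famVars s G).erase y.1
  card_rest : ∀ z : Lit V, z.1 = y.1 →
    (restIndex s G z).card = ((famVars s G).erase y.1).card + 1
  compl_deg : famDeg s G y.compl = 2

/-- For a variable with fewest occurrences the degree bound gives at most 2, and `hdeg` gives at
least 2. Thus each restriction loses one variable and two clauses. -/
theorem FamMU.exists_famSplit [DecidableEq ι] (h : FamMU s G) (hs : FamSaturated s G)
    (hd : s.card = (famVars s G).card + 2) (hdeg : ∀ z : Lit V, z.1 ∈ famVars s G →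
      2 ≤ famDeg s G z) : ∃ y, FamSplit s G y := by
  have hne : (famVars s G).Nonempty := by
    by_contra hne
    rw [Finset.not_nonempty_iff_eq_empty] at hne
    rw [hne, Finset.card_empty] at hd
    obtain ⟨i, hi, j, hj, hij⟩ := Finset.one_lt_card.1 (show 1 < s.card by omega)
    refine hij (h.eq_of_subset hi hj fun z hz => ?_)
    have := fst_mem_famVars hi hz
    simp [hne] at this
  obtain ⟨v, hv, hmin⟩ := exists_min_famOcc hne
  have h2 : ∀ z : Lit V, z.1 = v → famDeg s G z = 2 := by
    rintro z rfl
    have := h.famDeg_add_card_le hs hv hmin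
    have := hdeg z hv
    omega
  have hvars : ∀ z : Lit V, z.1 = v →
      famVars (restIndex s G z) (restFam G z) = (famVars s G).erase v := by
    rintro z rfl
    exact h.famVars_rest hv hmin
  refine ⟨(v, true), h, hdeg, hv, h2 _ rfl, ?_, hvars, ?_, h2 _ rfl⟩
  · rintro z hz
    exact h.rest hs (by rw [hz]; exact hv)
  · intro z hz
    have h3 := card_restIndex_add s G z
    have h4 := h2 z hz
    have h5 : _ = (famVars s G).card := Finset.card_erase_add_one hv
    show _ = ((famVars s G).erase v).card + 1
    omega

namespace FamSplit

variable {y : Lit V}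

theorem symm (h : FamSplit s G y) : FamSplit s G y.compl :=
  ⟨h.famMU, h.two_le, h.mem_vars, h.compl_deg, h.rest, h.vars_rest, h.card_rest, by
    simpa using h.deg⟩

theorem exists_pair (h : FamSplit s G y) : ∃ i ∈ s, ∃ j ∈ s, i ≠ j ∧ y ∈ G i ∧ y ∈ G j ∧
    ∀ k ∈ s, y ∈ G k → k = i ∨ k = j := by
  classical
  obtain ⟨i, j, hij, e⟩ := Finset.card_eq_two.1 h.deg
  have key : ∀ k, (k ∈ s ∧ y ∈ G k) ↔ k = i ∨ k = j := by
    intro k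
    simpa using Finset.ext_iff.1 e k
  exact ⟨i, ((key i).2 (Or.inl rfl)).1, j, ((key j).2 (Or.inr rfl)).1, hij,
    ((key i).2 (Or.inl rfl)).2, ((key j).2 (Or.inr rfl)).2, fun k hk hy => (key k).1 ⟨hk, hy⟩⟩

theorem mem_rest_compl (h : FamSplit s G y) {i : ι} (hi : i ∈ s) (hy : y ∈ G i) :
    i ∈ restIndex s G y.compl := mem_restIndex.2 ⟨hi, h.famMU.clashFree i hi y hy⟩

theorem card_rest' (h : FamSplit s G y) :
    (restIndex s G y).card = (famVars (restIndex s G y) (restFam G y)).card + 1 := by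
  rw [h.card_rest y rfl, h.vars_rest y rfl]

/-- The clauses containing `y` clash in at most one further variable. -/
theorem eq_of_clash [DecidableEq ι] (h : FamSplit s G y) {i j : ι} (hi : i ∈ s) (hj : j ∈ s)
    (hyi : y ∈ G i) (hyj : y ∈ G j) {z w : Lit V} (hz : z ∈ G i) (hz' : z.compl ∈ G j) (hw : w ∈ G i)
    (hw' : w.compl ∈ G j) : z = w := by
  have hne : ∀ {z}, z ∈ G i → z.compl ∈ G j → z ≠ y ∧ z.compl ≠ y := by
    intro z hz hz'
    constructor
    · rintro rfl
      exact h.famMU.clashFree j hj z hyj hz'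
    · rintro rfl
      exact h.famMU.clashFree i hi z hz hyi
  -- Both clauses survive making `y` false, which leaves a family of deficiency one.
  refine (h.rest y.compl rfl).eq_of_clash h.symm.card_rest' (h.mem_rest_compl hi hyi) (h.mem_rest_compl hj hyj)
    (mem_restFam.2 ⟨?_, hz⟩) (mem_restFam.2 ⟨?_, hz'⟩) (mem_restFam.2 ⟨?_, hw⟩)
    (mem_restFam.2 ⟨?_, hw'⟩)
  · simpa using (hne hz hz').1
  · simpa using (hne hz hz').2
  · simpa using (hne hw hw').1
  · simpa using (hne hw hw').2

/-- A variable occurring only twice after setting `y` to true yields a clash between the clauses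
containing `y`. -/
theorem exists_clash (h : FamSplit s G y) {w : V}
    (hw : w ∈ famVars (restIndex s G y) (restFam G y))
    (hw1 : ∀ z : Lit V, z.1 = w → famDeg (restIndex s G y) (restFam G y) z = 1) (z : Lit V)
    (hz : z.1 = w) : ∃ i ∈ s, ∃ j ∈ s, i ≠ j ∧ y ∈ G i ∧ y ∈ G j ∧ z ∈ G i ∧ z.compl ∈ G j := by
  have hne := fst_ne_of_mem_famVars_rest hw
  have hws : w ∈ famVars s G := by
    rw [h.vars_rest y rfl] at hw
    exact Finset.mem_of_mem_erase hw
  have key : ∀ z : Lit V, z.1 = w → ∃ i ∈ s, y ∈ G i ∧ z ∈ G i := by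
    rintro z rfl
    exact exists_mem_of_famDeg_rest (h.two_le z hws) (fun e => hne (e ▸ rfl)) (hw1 z rfl)
  obtain ⟨i, hi, hyi, hzi⟩ := key z hz
  obtain ⟨j, hj, hyj, hzj⟩ := key z.compl hz
  exact ⟨i, hi, j, hj, h.famMU.ne_of_compl_mem hi hzi hzj, hyi, hyj, hzi, hzj⟩

/-- Each such variable is a clash between the two clauses containing `y`, which have at most one
clash. -/
theorem eq_of_famDeg_eq_one [DecidableEq ι] (h : FamSplit s G y) {w w' : V}
    (hw : w ∈ famVars (restIndex s G y) (restFam G y))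
    (hw1 : ∀ z : Lit V, z.1 = w → famDeg (restIndex s G y) (restFam G y) z = 1)
    (hw' : w' ∈ famVars (restIndex s G y) (restFam G y))
    (hw1' : ∀ z : Lit V, z.1 = w' → famDeg (restIndex s G y) (restFam G y) z = 1) : w = w' := by
  obtain ⟨i, hi, j, hj, hij, hyi, hyj, hzi, hzj⟩ := h.exists_clash hw hw1 (w, true) rfl
  obtain ⟨k, hk, l, hl, hkl, hyk, hyl, hzk, hzl⟩ := h.exists_clash hw' hw1' (w', true) rfl
  obtain ⟨p, hp, q, hq, hpq, -, -, hu⟩ := h.exists_pair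
  have hcase : (k = i ∧ l = j) ∨ (k = j ∧ l = i) := by
    have h1 := hu i hi hyi
    have h2 := hu j hj hyj
    have h3 := hu k hk hyk
    have h4 := hu l hl hyl
    grind
  rcases hcase with ⟨rfl, rfl⟩ | ⟨rfl, rfl⟩
  · exact congrArg Prod.fst (h.eq_of_clash hi hj hyi hyj hzi hzj hzk hzl)
  · exact congrArg Prod.fst (h.eq_of_clash hi hj hyi hyj hzi hzj hzl (by simpa using hzk))

theorem vars_rest_nonempty (h : FamSplit s G y) :
    (famVars (restIndex s G y) (restFam G y)).Nonempty := by
  obtain ⟨i, hi, j, hj, hij, hyi, hyj, -⟩ := h.symm.exists_pair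
  have h1 := h.symm.mem_rest_compl hi hyi
  have h2 := h.symm.mem_rest_compl hj hyj
  rw [Lit.compl_compl] at h1 h2
  have h3 : 1 < (restIndex s G y).card := Finset.one_lt_card.2 ⟨i, h1, j, h2, hij⟩
  rw [h.card_rest y rfl] at h3
  rw [h.vars_rest y rfl]
  exact Finset.card_pos.1 (by omega)

theorem exists_twice [DecidableEq ι] (h : FamSplit s G y) :
    ∃ w ∈ famVars (restIndex s G y) (restFam G y),
      ∀ z : Lit V, z.1 = w → famDeg (restIndex s G y) (restFam G y) z = 1 :=
  (h.rest y rfl).exists_famDeg_eq_one h.card_rest' h.vars_rest_nonempty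

theorem exists_famChain [DecidableEq ι] (h : FamSplit s G y) {S : ι} (hS : S ∈ restIndex s G y)
    {w : V} (hw : w ∈ famVars (restIndex s G y) (restFam G y))
    (hw1 : ∀ z : Lit V, z.1 = w → famDeg (restIndex s G y) (restFam G y) z = 1)
    (hwS : w ∈ (restFam G y S).vars) :
    ∃ x L, FamChain (restIndex s G y) (restFam G y) S
      (famVars (restIndex s G y) (restFam G y)).card x L :=
  (h.rest y rfl).exists_famChain h.card_rest' hS
    (fun _ hv hv1 => h.eq_of_famDeg_eq_one hw hw1 hv hv1 ▸ hwS) y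

/-- Every other variable has a literal which occurs exactly once after setting `y` to true; this
literal occurs together with `y`. -/
theorem exists_lit [DecidableEq ι] (h : FamSplit s G y) {w : V} (hw : w ∈ famVars s G)
    (hwy : w ≠ y.1) :
    ∃ z : Lit V, z.1 = w ∧ famDeg (restIndex s G y) (restFam G y) z = 1 ∧
      ∃ i ∈ s, y ∈ G i ∧ z ∈ G i := by
  obtain ⟨v, hv, hv1⟩ := h.exists_twice
  obtain ⟨S, hS, t, ht, htv⟩ := mem_famVars.1 hv
  obtain ⟨x, L, hc⟩ := h.exists_famChain hS hv hv1 (Clause.mem_vars.2 ⟨t, ht, htv⟩)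
  have hw' : w ∈ famVars (restIndex s G y) (restFam G y) := by
    rw [h.vars_rest y rfl]
    exact Finset.mem_erase.2 ⟨hwy, hw⟩
  obtain ⟨i, hi, rfl⟩ := (hc.vars w).1 hw'
  exact ⟨x i, rfl, hc.famDeg_lit hi, exists_mem_of_famDeg_rest (h.two_le _ hw)
    (fun e => hwy (by rw [e]; rfl)) (hc.famDeg_lit hi)⟩

end FamSplit

end DeficiencyTwo

/-! ### Gluing the two restrictions to a cycle -/

section Cycle

variable {V ι : Type*} [DecidableEq V] [DecidableEq ι] {s : Finset ι} {G : ι → Clause V}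

/-- The clauses of the family are those of a cycle through the literals `p, x 0, …, x (m - 1)`. -/
theorem FamSplit.exists_cycle {p : Lit V} (h : FamSplit s G p) :
    ∃ (m : ℕ) (x : ℕ → Lit V), 0 < m ∧ (∀ i < m, (x i).1 ≠ p.1) ∧
      (∀ i < m, ∀ j < m, (x i).1 = (x j).1 → i = j) ∧
      ∃ (A₁ A₂ B₁ B₂ : ι) (L : ℕ → ι),
        (∀ k, k ∈ s ↔ k = A₁ ∨ k = A₂ ∨ k = B₁ ∨ k = B₂ ∨ ∃ i, i + 1 < m ∧ k = L (i + 1)) ∧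
        (∀ y, y ∈ G A₁ ↔ y = p.compl ∨ y = x 0) ∧
        (∀ y, y ∈ G A₂ ↔ y = p.compl ∨ ∃ i < m, y = (x i).compl) ∧
        (∀ y, y ∈ G B₁ ↔ y = p ∨ ∃ i < m, y = x i) ∧
        (∀ y, y ∈ G B₂ ↔ y = p ∨ y = (x (m - 1)).compl) ∧
        (∀ i, i + 1 < m → ∀ y, y ∈ G (L (i + 1)) ↔ y = x (i + 1) ∨ y = (x i).compl) := by
  have hMU := h.famMU
  obtain ⟨u, hu, hu1⟩ := h.exists_twice
  have hus := hu
  rw [h.vars_rest p rfl, Finset.mem_erase] at hus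
  -- `A₂` contains `p.compl` and the variable `u`, the only one occurring once in each sign after
  -- `p` is made true; so it can end the chain.
  obtain ⟨t, htu, -, A₂, hA₂, hpA₂, htA₂⟩ := h.symm.exists_lit hus.2 hus.1
  have hA₂r : A₂ ∈ restIndex s G p := by
    simpa using h.symm.mem_rest_compl hA₂ hpA₂
  have htp : t ≠ p.compl := fun e => hus.1 (by rw [← htu, e]; rfl)
  obtain ⟨x, L, hc⟩ := h.exists_famChain hA₂r hu hu1
    (Clause.mem_vars.2 ⟨t, mem_restFam.2 ⟨htp, htA₂⟩, htu⟩)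
  set m := (famVars (restIndex s G p) (restFam G p)).card with hm
  have hm0 : 0 < m := Finset.card_pos.2 h.vars_rest_nonempty
  have hvar : ∀ w, (w ∈ famVars s G ∧ w ≠ p.1) ↔ ∃ i < m, (x i).1 = w := by
    intro w
    rw [← hc.vars, h.vars_rest p rfl, Finset.mem_erase, and_comm]
  have hxs : ∀ i < m, (x i).1 ∈ famVars s G := fun i hi => ((hvar _).2 ⟨i, hi, rfl⟩).1
  have hxp : ∀ i < m, (x i).1 ≠ p.1 := fun i hi => ((hvar _).2 ⟨i, hi, rfl⟩).2
  -- transfer between clauses and their restrictions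
  have hR : ∀ {k}, k ∈ s → p ∉ G k → k ∈ restIndex s G p := fun hk hp => mem_restIndex.2 ⟨hk, hp⟩
  have hLs : ∀ i < m, L i ∈ s ∧ p ∉ G (L i) := fun i hi => mem_restIndex.1 (hc.mem i hi)
  have hpc : ∀ {k}, k ∈ s → p.compl ∈ G k → p ∉ G k := fun hk h1 h2 => hMU.clashFree _ hk p h2 h1
  have hxL : ∀ i < m, x i ∈ G (L i) := fun i hi => (mem_restFam.1 (hc.lit_mem i hi)).2
  have hxu : ∀ i < m, ∀ k ∈ s, p ∉ G k → x i ∈ G k → k = L i := fun i hi k hk hpk hxk =>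
    hc.eq_of_lit_mem hi (hR hk hpk) (mem_restFam.2 ⟨fun e => hxp i hi (by rw [e]; rfl), hxk⟩)
  have hxc : ∀ i < m, (x i).compl ≠ p.compl := fun i hi e =>
    hxp i hi (by rw [Lit.compl_injective e])
  have hLlt : ∀ i < m, ∀ j < m, (x j).compl ∈ G (L i) → j < i := fun i hi j hj hx =>
    hc.lt_of_compl_mem hi hj (mem_restFam.2 ⟨hxc j hj, hx⟩)
  obtain ⟨A₁, hA₁, hA₁₂, hpA₁, hAu⟩ : ∃ A₁ ∈ s, A₁ ≠ A₂ ∧ p.compl ∈ G A₁ ∧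
      ∀ k ∈ s, p.compl ∈ G k → k = A₁ ∨ k = A₂ := by
    obtain ⟨i, hi, j, hj, hij, hpi, hpj, hu⟩ := h.symm.exists_pair
    rcases hu A₂ hA₂ hpA₂ with rfl | rfl
    · exact ⟨j, hj, hij.symm, hpj, fun k hk hpk => (hu k hk hpk).symm⟩
    · exact ⟨i, hi, hij, hpi, hu⟩
  obtain ⟨a, ha, rfl⟩ : ∃ a < m, L a = A₁ := by
    rcases hc.surj A₁ (hR hA₁ (hpc hA₁ hpA₁)) with e | e
    · exact absurd e hA₁₂
    · exact e
  have hxA₂ : ∀ i < m, x i ∉ G A₂ := fun i hi hx =>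
    hc.ne_last i hi (hxu i hi A₂ hA₂ (hpc hA₂ hpA₂) hx).symm
  -- the clash between the clauses containing the complement of `p`
  obtain ⟨w, hw, hw1⟩ := h.symm.exists_twice
  have hwa : w = (x a).1 ∧ (x a).compl ∈ G A₂ := by
    obtain ⟨z, hzw, hz1, hz2⟩ : ∃ z : Lit V, z.1 = w ∧ z ∈ G (L a) ∧ z.compl ∈ G A₂ := by
      obtain ⟨i, hi, j, hj, hij, hpi, hpj, hzi, hzj⟩ := h.symm.exists_clash hw hw1 (w, true) rfl
      rcases hAu i hi hpi with rfl | rfl <;> rcases hAu j hj hpj with rfl | rfl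
      · exact absurd rfl hij
      · exact ⟨_, rfl, hzi, hzj⟩
      · exact ⟨Lit.compl (w, true), rfl, hzj, by simpa using hzi⟩
      · exact absurd rfl hij
    have hwp := fst_ne_of_mem_famVars_rest hw
    obtain ⟨j, hj, e⟩ := hc.eq_of_mem_last _ (mem_restFam.2 ⟨fun e => hwp (by
      rw [← hzw, Lit.compl_injective e]; rfl), hz2⟩)
    obtain rfl := Lit.compl_injective e
    obtain rfl : a = j := hc.inj ha hj (hxu j hj _ hA₁ (hpc hA₁ hpA₁) hz1)
    exact ⟨hzw.symm, hz2⟩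
  -- Making `p` false also leaves a literal of each variable with degree one, occurring together
  -- with `p.compl`. For `i ≠ a` it cannot be `x i`, which among the clauses without `p` occurs only
  -- in `L i`.
  have hdeg : ∀ i < m, famDeg (restIndex s G p.compl) (restFam G p.compl) (x i).compl = 1 ∧
      (i ≠ a → (x i).compl ∈ G (L a) ∨ (x i).compl ∈ G A₂) := by
    intro i hi
    by_cases hia : i = a
    · subst hia
      exact ⟨hw1 _ hwa.1.symm, fun h' => absurd rfl h'⟩
    · obtain ⟨z, hz, hz1, k, hk, hpk, hzk⟩ := h.symm.exists_lit (hxs i hi) (hxp i hi)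
      have hkA := hAu k hk hpk
      rcases Lit.eq_or_eq_compl hz with rfl | rfl
      · rcases hkA with rfl | rfl
        · exact absurd (hc.inj ha hi (hxu i hi _ hA₁ (hpc hA₁ hpA₁) hzk)).symm hia
        · exact absurd hzk (hxA₂ i hi)
      · refine ⟨hz1, fun _ => ?_⟩
        rcases hkA with rfl | rfl
        · exact Or.inl hzk
        · exact Or.inr hzk
  have hA₂mem : ∀ i < m, a ≤ i → (x i).compl ∈ G A₂ := by
    intro i hi hai
    by_cases hia : i = a
    · subst hia
      exact hwa.2
    · rcases (hdeg i hi).2 hia with h' | h'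
      · exact absurd (hLlt a ha i hi h') (by omega)
      · exact h'
  -- clauses containing `p`
  have hBx : ∀ i < m, ∃ k ∈ s, p ∈ G k ∧ x i ∈ G k := fun i hi =>
    exists_mem_of_famDeg_rest (h.two_le _ (hxs i hi)) (fun e => hxp i hi (by rw [e]; rfl))
      (hc.famDeg_lit hi)
  -- In the chain only `A₂` comes after `L (m - 1)`. So the last variable occurs once in each sign,
  -- and the two clauses containing `p` clash in it.
  have hlast : ∀ z : Lit V, z.1 = (x (m - 1)).1 →
      famDeg (restIndex s G p) (restFam G p) z = 1 := by
    have hm1 : m - 1 < m := by omega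
    intro z hz
    rcases Lit.eq_or_eq_compl hz with rfl | rfl
    · exact hc.famDeg_lit hm1
    · obtain ⟨k, hk, hxk⟩ := (h.rest p rfl).exists_compl_mem (hc.mem _ hm1) (hc.lit_mem _ hm1)
      have key : ∀ k ∈ restIndex s G p, (x (m - 1)).compl ∈ restFam G p k → k = A₂ := by
        intro k hk hxk
        rcases hc.surj k hk with e | ⟨i, hi, rfl⟩
        · exact e
        · exact absurd (hc.lt_of_compl_mem hi hm1 hxk) (by omega)
      obtain rfl := key k hk hxk
      exact famDeg_eq_one.2 ⟨k, hk, hxk, key⟩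
  obtain ⟨B₁, hB₁, B₂, hB₂, hB, hpB₁, hpB₂, hxB₁, hxB₂⟩ :=
    h.exists_clash ((hc.vars _).2 ⟨m - 1, by omega, rfl⟩) hlast (x (m - 1)) rfl
  have hBu : ∀ k ∈ s, p ∈ G k → k = B₁ ∨ k = B₂ := by
    obtain ⟨i, hi, j, hj, hij, hpi, hpj, hu⟩ := h.exists_pair
    intro k hk hpk
    have h1 := hu _ hB₁ hpB₁
    have h2 := hu _ hB₂ hpB₂
    have h3 := hu k hk hpk
    grind
  have hBx' : ∀ i < m, x i ∈ G B₁ ∨ x i ∈ G B₂ := by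
    intro i hi
    obtain ⟨k, hk, hpk, hxk⟩ := hBx i hi
    rcases hBu k hk hpk with rfl | rfl
    · exact Or.inl hxk
    · exact Or.inr hxk
  have hBc : ∀ i < m, (x i).compl ∈ G B₂ → i = m - 1 := by
    intro i hi hx
    refine hc.var_inj i hi _ (by omega) ?_
    rcases hBx' i hi with hx' | hx'
    · rw [h.eq_of_clash hB₁ hB₂ hpB₁ hpB₂ hx' hx hxB₁ hxB₂]
    · exact absurd hx (hMU.clashFree _ hB₂ _ hx')
  have hunit : ∀ i < m, ∀ k ∈ s, (∀ y ∈ G k, y = x i) → False := by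
    intro i hi k hk hy
    obtain ⟨j, hj, l, hl, hjl, hxj, hxl⟩ := two_le_famDeg.1 (h.two_le _ (hxs i hi))
    have key : ∀ j ∈ s, x i ∈ G j → k = j := fun j hj hxj =>
      hMU.eq_of_subset hk hj fun y hyk => (hy y hyk).symm ▸ hxj
    exact hjl ((key j hj hxj).symm.trans (key l hl hxl))
  have hLp : ∀ i < m, i ≠ a → p.compl ∉ G (L i) := by
    intro i hi hia hp
    rcases hAu _ (hLs i hi).1 hp with e | e
    · exact hia (hc.inj hi ha e)
    · exact hc.ne_last i hi e
  have hLmem : ∀ i < m, i ≠ a → ∀ y ∈ G (L i), y = x i ∨ ∃ j < i, y = (x j).compl :=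
    fun i hi hia y hy => hc.eq_of_mem i hi y (mem_restFam.2 ⟨fun e => hLp i hi hia (e ▸ hy), hy⟩)
  -- `L 0` has no earlier literals to contain; without `p.compl` it would be a unit clause.
  obtain rfl : a = 0 := by
    by_contra ha0
    refine hunit 0 hm0 (L 0) (hLs 0 hm0).1 fun y hy => ?_
    rcases hLmem 0 hm0 (Ne.symm ha0) y hy with e | ⟨j, hj, -⟩
    · exact e
    · omega
  have hcu : ∀ j < m, ∀ i < m, ∀ i' < m, i ≠ 0 → i' ≠ 0 → (x j).compl ∈ G (L i) →
      (x j).compl ∈ G (L i') → i = i' := by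
    intro j hj i hi i' hi' h0 h0' hx hx'
    obtain ⟨k, -, -, hk⟩ := famDeg_eq_one.1 (hdeg j hj).1
    have key : ∀ i < m, i ≠ 0 → (x j).compl ∈ G (L i) → L i = k := fun i hi h0 hx =>
      hk _ (mem_restIndex.2 ⟨(hLs i hi).1, hLp i hi h0⟩) (mem_restFam.2
        ⟨fun e => hxp j hj (by rw [Lit.compl_injective e]; rfl), hx⟩)
    exact hc.inj hi hi' ((key i hi h0 hx).trans (key i' hi' h0' hx').symm)
  -- `L (i + 1)` is not a unit clause, so it contains the complement of some `x j` with `j ≤ i`. For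
  -- `j < i` that complement is already used up by `L (j + 1)`, as `hcu` allows it only one such
  -- clause.
  have hprev : ∀ i, i + 1 < m → (x i).compl ∈ G (L (i + 1)) := by
    intro i
    induction i using Nat.strong_induction_on with
    | _ i ih =>
      intro hi
      by_contra hx
      refine hunit (i + 1) hi _ (hLs _ hi).1 fun y hy => ?_
      rcases hLmem (i + 1) hi (by omega) y hy with e | ⟨j, hj, rfl⟩
      · exact e
      · have hji : j ≠ i := by
          rintro rfl
          exact hx hy
        have := hcu j (by omega) _ hi (j + 1) (by omega) (by omega) (by omega) hy
          (ih j (by omega) (by omega))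
        omega
  -- the negative clause containing `p`
  have hxB₂' : ∀ i < m, x i ∉ G B₂ := by
    intro i hi hxi
    classical
    -- If `B₂` contained some `x i`, every clause without `p.compl` would contain some `x j`; making
    -- all of them true would satisfy the restriction by `p.compl`.
    obtain ⟨f, hf⟩ : ∃ f : V → Bool, ∀ j < m, (x j).Holds f := by
      refine ⟨fun w => decide (∃ j < m, x j = (w, true)), fun j hj => ?_⟩
      unfold Lit.Holds
      rcases hxj : (x j).2 with _ | _
      · simp only [decide_eq_false_iff_not, not_exists, not_and]
        intro l hl e
        obtain rfl := hc.var_inj l hl j hj (by rw [e])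
        rw [e] at hxj
        exact absurd hxj (by simp)
      · simp only [decide_eq_true_eq]
        exact ⟨j, hj, Prod.ext rfl hxj⟩
    obtain ⟨k, hk, hkf⟩ := (h.rest p.compl rfl).unsat f
    rw [mem_restIndex] at hk
    have hkx : ∀ j < m, x j ∉ G k := fun j hj hx =>
      hkf _ (mem_restFam.2 ⟨fun e => hxp j hj (by rw [e]; simp), hx⟩) (hf j hj)
    by_cases hpk : p ∈ G k
    · rcases hBu k hk.1 hpk with rfl | rfl
      · exact hkx _ (by omega) hxB₁
      · exact hkx i hi hxi
    · rcases hc.surj k (hR hk.1 hpk) with rfl | ⟨j, hj, rfl⟩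
      · exact hk.2 hpA₂
      · exact hkx j hj (hxL j hj)
  have hxB₁' : ∀ i < m, x i ∈ G B₁ := fun i hi => (hBx' i hi).resolve_right (hxB₂' i hi)
  have hlit : ∀ {k y}, k ∈ s → y ∈ G k → y = p ∨ y = p.compl ∨ ∃ i < m, y = x i ∨
      y = (x i).compl := by
    intro k y hk hy
    by_cases hyp : y.1 = p.1
    · rcases Lit.eq_or_eq_compl hyp with e | e
      · exact Or.inl e
      · exact Or.inr (Or.inl e)
    · obtain ⟨i, hi, e⟩ := (hvar y.1).1 ⟨fst_mem_famVars hk hy, hyp⟩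
      exact Or.inr (Or.inr ⟨i, hi, Lit.eq_or_eq_compl e.symm⟩)
  refine ⟨m, x, hm0, hxp, hc.var_inj, L 0, A₂, B₁, B₂, L, ?_, ?_, ?_, ?_, ?_, ?_⟩
  · intro k
    constructor
    · intro hk
      by_cases hpk : p ∈ G k
      · rcases hBu k hk hpk with e | e
        · exact Or.inr (Or.inr (Or.inl e))
        · exact Or.inr (Or.inr (Or.inr (Or.inl e)))
      · rcases hc.surj k (hR hk hpk) with e | ⟨i, hi, e⟩
        · exact Or.inr (Or.inl e)
        · rcases i with _ | i
          · exact Or.inl e.symm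
          · exact Or.inr (Or.inr (Or.inr (Or.inr ⟨i, hi, e.symm⟩)))
    · rintro (rfl | rfl | rfl | rfl | ⟨i, hi, rfl⟩)
      exacts [hA₁, hA₂, hB₁, hB₂, (hLs _ hi).1]
  · intro y
    constructor
    · intro hy
      by_cases hyp : y = p.compl
      · exact Or.inl hyp
      · rcases hc.eq_of_mem 0 hm0 y (mem_restFam.2 ⟨hyp, hy⟩) with e | ⟨j, hj, -⟩
        · exact Or.inr e
        · omega
    · rintro (rfl | rfl)
      exacts [hpA₁, hxL 0 hm0]
  · intro y
    constructor
    · intro hy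
      by_cases hyp : y = p.compl
      · exact Or.inl hyp
      · exact Or.inr (hc.eq_of_mem_last y (mem_restFam.2 ⟨hyp, hy⟩))
    · rintro (rfl | ⟨i, hi, rfl⟩)
      exacts [hpA₂, hA₂mem i hi (Nat.zero_le i)]
  · intro y
    constructor
    · intro hy
      rcases hlit hB₁ hy with e | rfl | ⟨i, hi, e | rfl⟩
      · exact Or.inl e
      · exact absurd hpB₁ (hpc hB₁ hy)
      · exact Or.inr ⟨i, hi, e⟩
      · exact absurd hy (hMU.clashFree _ hB₁ _ (hxB₁' i hi))
    · rintro (rfl | ⟨i, hi, rfl⟩)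
      exacts [hpB₁, hxB₁' i hi]
  · intro y
    constructor
    · intro hy
      rcases hlit hB₂ hy with e | rfl | ⟨i, hi, rfl | rfl⟩
      · exact Or.inl e
      · exact absurd hpB₂ (hpc hB₂ hy)
      · exact absurd hy (hxB₂' i hi)
      · exact Or.inr (by rw [hBc i hi hy])
    · rintro (rfl | rfl)
      exacts [hpB₂, hxB₂]
  · intro i hi y
    constructor
    · intro hy
      rcases hLmem (i + 1) hi (by omega) y hy with e | ⟨j, hj, rfl⟩
      · exact Or.inl e
      · have := hcu j (by omega) _ hi (j + 1) (by omega) (by omega) (by omega) hy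
          (hprev j (by omega))
        obtain rfl : i = j := by omega
        exact Or.inr rfl
    · rintro (rfl | rfl)
      exacts [hxL _ hi, hprev i hi]

end Cycle

/-! ### Cycles through given literals, and their isomorphisms -/

namespace ClauseSet

section CycleOn

variable {V : Type*} [DecidableEq V] {n : ℕ}

/-- The literal map induced by replacing the `i`-th variable by the literal `z i`. -/
def litMap (z : Fin n → Lit V) (q : Lit (Fin n)) : Lit V := if q.2 then z q.1 else (z q.1).compl

/-- The clause-set `cycle n` with the `i`-th variable replaced by the literal `z i`. -/
def cycleOn (z : Fin n → Lit V) : ClauseSet V := (cycle n).image fun D => D.image (litMap z)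

omit [DecidableEq V] in
theorem litMap_compl (z : Fin n → Lit V) (q : Lit (Fin n)) :
    litMap z q.compl = (litMap z q).compl := by
  obtain ⟨i, b⟩ := q
  cases b <;> simp [litMap, Lit.compl]

omit [DecidableEq V] in
theorem litMap_fst (z : Fin n → Lit V) (q : Lit (Fin n)) : (litMap z q).1 = (z q.1).1 := by
  obtain ⟨i, b⟩ := q
  cases b <;> simp [litMap]

omit [DecidableEq V] in
theorem exists_litMap_eq {z : Fin n → Lit V} {y : Lit V} {i : Fin n} (h : (z i).1 = y.1) :
    ∃ b, litMap z (i, b) = y := by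
  rcases Lit.eq_or_eq_compl h with e | e
  · exact ⟨true, by simpa [litMap] using e⟩
  · exact ⟨false, by simp [litMap, e]⟩

omit [DecidableEq V] in
theorem litMap_injective {z : Fin n → Lit V} (hz : Function.Injective fun i => (z i).1) :
    Function.Injective (litMap z) := by
  rintro ⟨i, b⟩ ⟨j, c⟩ e
  have e1 := congrArg Prod.fst e
  rw [litMap_fst, litMap_fst] at e1
  obtain rfl : i = j := hz e1
  cases b <;> cases c <;> simp only [litMap, if_true] at e
  · rfl
  · exact absurd e (Lit.compl_ne _)
  · exact absurd e.symm (Lit.compl_ne _)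
  · rfl

theorem mem_cycleOn {z : Fin n → Lit V} {C : Clause V} : C ∈ cycleOn z ↔
    C = Finset.univ.image z ∨ C = Finset.univ.image (fun i => (z i).compl) ∨
      ∃ i, C = {(z i).compl, z (finRotate n i)} := by
  simp only [cycleOn, cycle, Finset.mem_image, Finset.mem_union, Finset.mem_insert,
    Finset.mem_singleton, Finset.mem_univ, true_and]
  constructor
  · rintro ⟨D, (rfl | rfl) | ⟨i, rfl⟩, rfl⟩
    · left
      rw [Finset.image_image]; rfl
    · right; left
      rw [Finset.image_image]; rfl
    · exact Or.inr (Or.inr ⟨i, by simp [Finset.image_insert, litMap]⟩)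
  · rintro (rfl | rfl | ⟨i, rfl⟩)
    · exact ⟨_, Or.inl (Or.inl rfl), by rw [Finset.image_image]; rfl⟩
    · exact ⟨_, Or.inl (Or.inr rfl), by rw [Finset.image_image]; rfl⟩
    · exact ⟨_, Or.inr ⟨i, rfl⟩, by simp [Finset.image_insert, litMap]⟩

theorem cycleOn_self (n : ℕ) : cycleOn (fun i : Fin n => ((i, true) : Lit (Fin n))) = cycle n := by
  have : litMap (fun i : Fin n => ((i, true) : Lit (Fin n))) = id := by
    funext ⟨i, b⟩
    cases b <;> rfl
  simp [cycleOn, this]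

theorem mem_vars_cycleOn {z : Fin n → Lit V} {v : V} : v ∈ (cycleOn z).vars ↔ ∃ i, (z i).1 = v := by
  rw [vars_eq_famVars, mem_famVars]
  constructor
  · rintro ⟨C, hC, y, hy, rfl⟩
    obtain ⟨D, -, rfl⟩ := Finset.mem_image.1 hC
    obtain ⟨q, -, rfl⟩ := Finset.mem_image.1 hy
    exact ⟨q.1, (litMap_fst z q).symm⟩
  · rintro ⟨i, rfl⟩
    exact ⟨_, mem_cycleOn.2 (Or.inl rfl), z i, Finset.mem_image_of_mem z (Finset.mem_univ i), rfl⟩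

theorem card_vars_cycleOn {z : Fin n → Lit V} (hz : Function.Injective fun i => (z i).1) :
    (cycleOn z).vars.card = n := by
  have : (cycleOn z).vars = Finset.univ.image fun i => (z i).1 := by
    ext v
    simp [mem_vars_cycleOn]
  rw [this, Finset.card_image_of_injective _ hz, Finset.card_fin]

/-- All literals of a cycle occur exactly twice. -/
theorem ldeg_cycleOn {z : Fin n → Lit V} (hz : Function.Injective fun i => (z i).1) {y : Lit V}
    (hy : y.1 ∈ (cycleOn z).vars) : (cycleOn z).ldeg y = 2 := by
  have hinj : ∀ {i j}, z i = z j → i = j := fun e => hz (congrArg Prod.fst e)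
  have hne : ∀ i j, z i ≠ (z j).compl := by
    intro i j e
    obtain rfl : i = j := hz (show (z i).1 = (z j).1 by rw [e, Lit.compl_fst])
    exact Lit.compl_ne _ e.symm
  obtain ⟨i, hi⟩ := mem_vars_cycleOn.1 hy
  rw [ldeg, Finset.card_eq_two]
  rcases Lit.eq_or_eq_compl hi.symm with rfl | rfl
  · refine ⟨Finset.univ.image z, {(z ((finRotate n).symm i)).compl, z i}, ?_, ?_⟩
    · intro e
      have := Finset.ext_iff.1 e (z ((finRotate n).symm i)).compl
      simp [hne] at this
    · ext C
      simp only [Finset.mem_filter, mem_cycleOn, Finset.mem_insert, Finset.mem_singleton]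
      constructor
      · rintro ⟨rfl | rfl | ⟨j, rfl⟩, hC⟩
        · exact Or.inl rfl
        · simp only [Finset.mem_image, Finset.mem_univ, true_and] at hC
          obtain ⟨j, hj⟩ := hC
          exact absurd hj.symm (hne i j)
        · simp only [Finset.mem_insert, hne, Finset.mem_singleton, false_or] at hC
          obtain rfl := hinj hC
          exact Or.inr (by rw [Equiv.symm_apply_apply])
      · rintro (rfl | rfl)
        · exact ⟨Or.inl rfl, by simp⟩
        · exact ⟨Or.inr (Or.inr ⟨(finRotate n).symm i, by rw [Equiv.apply_symm_apply]⟩), by simp⟩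
  · refine ⟨Finset.univ.image fun i => (z i).compl, {(z i).compl, z (finRotate n i)}, ?_, ?_⟩
    · intro e
      have := Finset.ext_iff.1 e (z (finRotate n i))
      simp only [Finset.mem_image, Finset.mem_univ, true_and, Finset.mem_insert,
        Finset.mem_singleton, or_true, iff_true] at this
      obtain ⟨j, hj⟩ := this
      exact hne _ _ hj.symm
    · ext C
      simp only [Finset.mem_filter, mem_cycleOn, Finset.mem_insert, Finset.mem_singleton]
      constructor
      · rintro ⟨rfl | rfl | ⟨j, rfl⟩, hC⟩
        · simp only [Finset.mem_image, Finset.mem_univ, true_and] at hC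
          obtain ⟨j, hj⟩ := hC
          exact absurd hj (hne j i)
        · exact Or.inl rfl
        · simp only [Finset.mem_insert, Finset.mem_singleton, (hne _ _).symm, or_false] at hC
          obtain rfl := hinj (Lit.compl_injective hC)
          exact Or.inr rfl
      · rintro (rfl | rfl)
        · exact ⟨Or.inr (Or.inl rfl), by simp⟩
        · exact ⟨Or.inr (Or.inr ⟨i, rfl⟩), by simp⟩

theorem nonsingular_cycleOn {z : Fin n → Lit V} (hz : Function.Injective fun i => (z i).1) :
    (cycleOn z).Nonsingular := by
  intro v hv
  by_cases hmem : v ∈ (cycleOn z).vars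
  · rw [Singular, ldeg_cycleOn hz (y := (v, true)) hmem,
      ldeg_cycleOn hz (y := (v, false)) hmem] at hv
    simp at hv
  · have : (cycleOn z).ldeg (v, true) = 0 := by
      rw [ldeg, Finset.card_eq_zero, Finset.filter_eq_empty_iff]
      intro C hC hvC
      exact hmem (fst_mem_famVars (G := id) hC hvC)
    rw [Singular, this] at hv
    simp at hv

variable {W : Type*} [DecidableEq W]

/-- The bijection from the literals of `cycle n` to those of `cycleOn z`. -/
noncomputable def cycleOnEquiv {z : Fin n → Lit V} (hz : Function.Injective fun i => (z i).1) :
    Lit (Fin n) ≃ (cycleOn z).LitOf :=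
  Equiv.ofBijective
    (fun q => ⟨litMap z q, mem_vars_cycleOn.2 ⟨q.1, (litMap_fst z q).symm⟩⟩)
    ⟨fun _ _ e => litMap_injective hz (congrArg Subtype.val e), fun ⟨y, hy⟩ => by
      obtain ⟨i, hi⟩ := mem_vars_cycleOn.1 hy
      obtain ⟨b, hb⟩ := exists_litMap_eq hi
      exact ⟨(i, b), Subtype.ext hb⟩⟩

theorem map_cycleOnEquiv_mem {z : Fin n → Lit V} (hz : Function.Injective fun i => (z i).1)
    (D : Clause (Fin n)) :
    (D.map (cycleOnEquiv hz).toEmbedding).map (.subtype _) ∈ cycleOn z ↔ D ∈ cycle n := by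
  have : (D.map (cycleOnEquiv hz).toEmbedding).map (.subtype _) = D.image (litMap z) := by
    rw [Finset.map_map, Finset.map_eq_image]
    rfl
  rw [this, cycleOn, Finset.mem_image]
  constructor
  · rintro ⟨E, hE, e⟩
    rwa [← Finset.image_injective (litMap_injective hz) e]
  · exact fun h => ⟨D, h, rfl⟩

theorem iso_cycleOn {z : Fin n → Lit V} {z' : Fin n → Lit W}
    (hz : Function.Injective fun i => (z i).1) (hz' : Function.Injective fun i => (z' i).1) :
    (cycleOn z).Iso (cycleOn z') := by
  refine ⟨(cycleOnEquiv hz).symm.trans (cycleOnEquiv hz'), ?_, ?_⟩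
  · intro x
    obtain ⟨q, rfl⟩ := (cycleOnEquiv hz).surjective x
    have : (cycleOnEquiv hz q).compl = cycleOnEquiv hz q.compl :=
      Subtype.ext (litMap_compl z q).symm
    rw [this]
    simp only [Equiv.trans_apply, Equiv.symm_apply_apply]
    exact Subtype.ext (litMap_compl z' q)
  · intro C
    obtain ⟨D, rfl⟩ : ∃ D : Clause (Fin n), C = D.map (cycleOnEquiv hz).toEmbedding :=
      ⟨C.map (cycleOnEquiv hz).symm.toEmbedding, by
        rw [Finset.map_map]
        ext x
        simp⟩
    have : (D.map (cycleOnEquiv hz).toEmbedding).map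
        ((cycleOnEquiv hz).symm.trans (cycleOnEquiv hz')).toEmbedding =
        D.map (cycleOnEquiv hz').toEmbedding := by
      rw [Finset.map_map]
      congr 1
      exact Function.Embedding.ext fun q =>
        congrArg (cycleOnEquiv hz') ((cycleOnEquiv hz).symm_apply_apply q)
    rw [this, map_cycleOnEquiv_mem, map_cycleOnEquiv_mem]

theorem iso_cycle {z : Fin n → Lit V} (hz : Function.Injective fun i => (z i).1) :
    (cycleOn z).Iso (cycle n) := by
  rw [← cycleOn_self]
  exact iso_cycleOn hz fun _ _ e => e

/-- Clause-sets isomorphic to a cycle are cycles through suitable literals. -/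
theorem Iso.exists_eq_cycleOn {F : ClauseSet V} (h : F.Iso (cycle n)) :
    ∃ z : Fin n → Lit V, (Function.Injective fun i => (z i).1) ∧ F = cycleOn z := by
  obtain ⟨e, he, hC⟩ := h
  have hmem : ∀ q : Lit (Fin n), q.1 ∈ (cycle n).vars := by
    intro q
    rw [← cycleOn_self, mem_vars_cycleOn]
    exact ⟨q.1, rfl⟩
  set g : Lit (Fin n) → F.LitOf := fun q => e.symm ⟨q, hmem q⟩ with hg
  have hgc : ∀ q, g q.compl = (g q).compl := by
    intro q
    apply e.injective
    rw [he]
    simp [hg, LitOf.compl]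
  have hginj : Function.Injective g := fun q r hqr =>
    congrArg Subtype.val (e.symm.injective hqr)
  have hlit : ∀ q, litMap (fun i => (g (i, true)).1) q = (g q).1 := by
    rintro ⟨i, b⟩
    cases b
    · exact congrArg Subtype.val (hgc (i, true)).symm
    · rfl
  have hmap : ∀ D : Clause (Fin n), D.image (litMap fun i => (g (i, true)).1) ∈ F ↔
      D ∈ cycle n := by
    intro D
    have h1 : D.image (litMap fun i => (g (i, true)).1) =
        (D.map ⟨g, hginj⟩).map (.subtype _) := by
      rw [Finset.map_map, Finset.map_eq_image]
      exact Finset.image_congr fun q _ => hlit q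
    have h2 : ((D.map ⟨g, hginj⟩).map e.toEmbedding).map (.subtype _) = D := by
      ext q
      simpa [hg] using fun _ => hmem q
    rw [h1, hC, h2]
  refine ⟨fun i => (g (i, true)).1, ?_, ?_⟩
  · intro i j hij
    rcases Lit.eq_or_eq_compl hij with e' | e'
    · exact congrArg Prod.fst (hginj (Subtype.ext e'))
    · have : (g (i, true)) = g (Lit.compl (j, true)) := by
        rw [hgc]
        exact Subtype.ext e'
      exact congrArg Prod.fst (hginj this)
  · ext C
    rw [cycleOn, Finset.mem_image]
    constructor
    · intro hCF
      have hCim : (Finset.univ.filter fun q => (g q).1 ∈ C).image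
          (litMap fun i => (g (i, true)).1) = C := by
        ext y
        simp only [Finset.mem_image, Finset.mem_filter, Finset.mem_univ, true_and, hlit]
        constructor
        · rintro ⟨q, hq, rfl⟩
          exact hq
        · intro hy
          have hgy : g (e ⟨y, fst_mem_famVars (G := id) hCF hy⟩).1 = ⟨y, _⟩ :=
            e.symm_apply_apply _
          exact ⟨(e ⟨y, fst_mem_famVars (G := id) hCF hy⟩).1, by rw [hgy]; exact hy, by rw [hgy]⟩
      exact ⟨_, (hmap _).1 (hCim.symm ▸ hCF), hCim⟩
    · rintro ⟨D, hD, rfl⟩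
      exact (hmap D).2 hD

end CycleOn

/-! ### Classification of the nonsingular case -/

variable {V ι : Type*} [DecidableEq V]

theorem _root_.FamSplit.exists_image_eq_cycleOn [DecidableEq ι] {s : Finset ι} {G : ι → Clause V}
    {p : Lit V} (h : FamSplit s G p) : ∃ (n : ℕ) (z : Fin n → Lit V), 2 ≤ n ∧
      (Function.Injective fun i => (z i).1) ∧ s.image G = cycleOn z := by
  obtain ⟨m, x, hm, hxp, hx, A₁, A₂, B₁, B₂, L, hs, hA₁, hA₂, hB₁, hB₂, hL⟩ := h.exists_cycle
  obtain ⟨m, rfl⟩ : ∃ l, m = l + 1 := ⟨m - 1, by omega⟩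
  rw [Nat.add_sub_cancel] at hB₂
  -- `p` takes position 0 and `x i` position `i + 1`. `A₁` is the edge leaving `p`, `B₂` the edge
  -- returning to it, and `B₁`, `A₂` are the two long clauses.
  set z : Fin (m + 2) → Lit V := Fin.cons p fun i => x i with hz
  have hrot : ∀ i : Fin (m + 1), finRotate (m + 2) i.castSucc = i.succ := by
    intro i
    simp
  have hedge : ∀ i : Fin (m + 1), z (finRotate (m + 2) i.castSucc) = x i := by
    intro i
    rw [hrot, hz, Fin.cons_succ]
  have hedge' : z (finRotate (m + 2) (Fin.last (m + 1))) = p := by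
    rw [finRotate_last]
    rfl
  have e0 : z 0 = p := rfl
  have es : ∀ i : Fin (m + 1), z i.succ = x i := fun i => rfl
  have hpos : G B₁ = Finset.univ.image z := by
    ext y
    simp only [hB₁, Finset.mem_image, Finset.mem_univ, true_and]
    constructor
    · rintro (rfl | ⟨i, hi, rfl⟩)
      exacts [⟨0, e0⟩, ⟨Fin.succ ⟨i, hi⟩, es _⟩]
    · rintro ⟨i, rfl⟩
      exact Fin.cases (Or.inl e0) (fun i => Or.inr ⟨i, i.2, es i⟩) i
  have hneg : G A₂ = Finset.univ.image fun i => (z i).compl := by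
    ext y
    simp only [hA₂, Finset.mem_image, Finset.mem_univ, true_and]
    constructor
    · rintro (rfl | ⟨i, hi, rfl⟩)
      exacts [⟨0, rfl⟩, ⟨Fin.succ ⟨i, hi⟩, rfl⟩]
    · rintro ⟨i, rfl⟩
      exact Fin.cases (Or.inl rfl) (fun i => Or.inr ⟨i, i.2, rfl⟩) i
  have h1 : G A₁ = {(z (Fin.castSucc 0)).compl, z (finRotate (m + 2) (Fin.castSucc 0))} := by
    rw [hedge]
    ext y
    simp [hA₁, e0]
  have h2 : G B₂ = {(z (Fin.last (m + 1))).compl, z (finRotate (m + 2) (Fin.last (m + 1)))} := by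
    rw [hedge']
    ext y
    have : z (Fin.last (m + 1)) = x m := es (Fin.last m)
    simp [hB₂, this, or_comm]
  have h3 : ∀ i : Fin m, G (L (i + 1)) =
      {(z i.succ.castSucc).compl, z (finRotate (m + 2) i.succ.castSucc)} := by
    intro i
    rw [hedge]
    ext y
    have : z i.succ.castSucc = x i := es i.castSucc
    rw [hL i (by omega), this]
    simp [or_comm]
  refine ⟨m + 2, z, by omega, ?_, ?_⟩
  · intro i j e
    refine Fin.cases (fun e => ?_) (fun i e => ?_) i e <;> revert e <;>
      refine Fin.cases (fun e => ?_) (fun j e => ?_) j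
    · rfl
    · exact absurd e.symm (hxp j j.2)
    · exact absurd e (hxp i i.2)
    · exact congrArg _ (Fin.ext (hx i i.2 j j.2 e))
  · ext C
    rw [Finset.mem_image, mem_cycleOn]
    constructor
    · rintro ⟨k, hk, rfl⟩
      rcases (hs k).1 hk with rfl | rfl | rfl | rfl | ⟨i, hi, rfl⟩
      · exact Or.inr (Or.inr ⟨_, h1⟩)
      · exact Or.inr (Or.inl hneg)
      · exact Or.inl hpos
      · exact Or.inr (Or.inr ⟨_, h2⟩)
      · exact Or.inr (Or.inr ⟨_, h3 ⟨i, by omega⟩⟩)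
    · rintro (rfl | rfl | ⟨i, rfl⟩)
      · exact ⟨B₁, (hs _).2 (by simp), hpos⟩
      · exact ⟨A₂, (hs _).2 (by simp), hneg⟩
      · refine Fin.lastCases ?_ (fun i => ?_) i
        · exact ⟨B₂, (hs _).2 (by simp), h2⟩
        · refine Fin.cases ?_ (fun i => ?_) i
          · exact ⟨A₁, (hs _).2 (by simp), h1⟩
          · exact ⟨L (i + 1), (hs _).2 (Or.inr (Or.inr (Or.inr (Or.inr ⟨i, by omega, rfl⟩)))),
              h3 i⟩

/-- Nonsingular minimally unsatisfiable clause-sets of deficiency two are cycles. -/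
theorem MinUnsat.exists_eq_cycleOn {F : ClauseSet V} (h : F.MinUnsat) (hd : F.deficiency = 2)
    (hns : F.Nonsingular) : ∃ (n : ℕ) (z : Fin n → Lit V), 2 ≤ n ∧
      (Function.Injective fun i => (z i).1) ∧ F = cycleOn z := by
  have hF := minUnsat_iff.1 h
  have hdeg : ∀ y : Lit V, y.1 ∈ famVars F id → 2 ≤ famDeg F id y := by
    intro y hy
    have h1 := famDeg_pos.2 (hF.exists_mem_of_fst_mem hy)
    by_contra hlt
    obtain ⟨i, hi, hyi, hu⟩ := famDeg_eq_one.1 (show famDeg F id y = 1 by omega)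
    exact hns y.1 (h.singular_iff.2 ⟨y, i, rfl, hi, hyi, hu, hF.exists_compl_mem hi hyi⟩)
  obtain ⟨G, hle, hG, hv, hs⟩ := hF.exists_saturated
  have hcard : F.card = (famVars F G).card + 2 := by
    rw [hv, ← vars_eq_famVars]
    unfold deficiency at hd
    omega
  obtain ⟨p, hp⟩ := hG.exists_famSplit hs hcard fun y hy =>
    (hdeg y (hv ▸ hy)).trans (famDeg_mono (fun i _ => hle i) y)
  obtain ⟨n, z, hn, hz, e⟩ := hp.exists_image_eq_cycleOn
  refine ⟨n, z, hn, hz, ?_⟩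
  rw [← e]
  -- In the cycle every literal has degree 2, and in `F` it already had at least that; so both have
  -- the same occurrences.
  have hfix : ∀ C ∈ F, G C = C := by
    intro C hC
    refine Finset.Subset.antisymm (fun y hy => ?_) (hle C)
    have hyv : y.1 ∈ famVars F G := fst_mem_famVars hC hy
    have h2 : famDeg F G y = 2 := by
      rw [← ldeg_image hG.injOn, e]
      refine ldeg_cycleOn hz ?_
      rwa [← e, vars_image]
    have hsub : F.filter (fun C => y ∈ id C) ⊆ F.filter fun C => y ∈ G C := by
      intro D hD
      rw [Finset.mem_filter] at hD ⊢
      exact ⟨hD.1, hle D hD.2⟩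
    have heq := Finset.eq_of_subset_of_card_le hsub (by
      have := hdeg y (hv ▸ hyv)
      unfold famDeg at h2 this
      omega)
    have : C ∈ F.filter fun C => y ∈ G C := Finset.mem_filter.2 ⟨hC, hy⟩
    rw [← heq] at this
    exact (Finset.mem_filter.1 this).2
  rw [Finset.image_congr (g := id) fun C hC => hfix C hC, Finset.image_id]

end ClauseSet

/-! ### The main theorem -/

theorem theorem7 {V : Type*} [DecidableEq V] (F : ClauseSet V)
    (hF : F.MinUnsat) (hδ : F.deficiency = 2) :
    F.ConfluentModIso ∧ F.sDP.Nonempty ∧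
      ∃ n : ℕ, 2 ≤ n ∧ (∀ F' ∈ F.sDP, F'.Iso (ClauseSet.cycle n)) ∧
        ∀ m : ℕ, F.HasNonsingularityType m ↔ m = n := by
  obtain ⟨F₀, hF₀⟩ := hF.sDP_nonempty
  have hcyc : ∀ F' ∈ F.sDP, ∃ (n : ℕ) (z : Fin n → Lit V), 2 ≤ n ∧
      (Function.Injective fun i => (z i).1) ∧ F' = ClauseSet.cycleOn z := fun F' hF' =>
    hF'.1.exists_eq_cycleOn ((hF.of_reduces hF'.2.2).2.trans hδ) hF'.2.1
  obtain ⟨n, z₀, hn, hz₀, e₀⟩ := hcyc F₀ hF₀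
  have hcard : F₀.vars.card = n := by rw [e₀, ClauseSet.card_vars_cycleOn hz₀]
  have hall : ∀ F' ∈ F.sDP, ∃ z : Fin n → Lit V,
      (Function.Injective fun i => (z i).1) ∧ F' = ClauseSet.cycleOn z := by
    intro F' hF'
    obtain ⟨n', z, -, hz, rfl⟩ := hcyc F' hF'
    have := hF.card_vars_eq hF' hF₀
    rw [hcard, ClauseSet.card_vars_cycleOn hz] at this
    subst this
    exact ⟨z, hz, rfl⟩
  refine ⟨⟨hF, ?_⟩, ⟨F₀, hF₀⟩, n, hn, ?_, ?_⟩
  · intro F' hF' F'' hF''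
    obtain ⟨z, hz, rfl⟩ := hall F' hF'
    obtain ⟨z', hz', rfl⟩ := hall F'' hF''
    exact ClauseSet.iso_cycleOn hz hz'
  · intro F' hF'
    obtain ⟨z, hz, rfl⟩ := hall F' hF'
    exact ClauseSet.iso_cycle hz
  · intro m
    constructor
    · rintro ⟨-, F', hr, hiso⟩
      -- A reduct isomorphic to a cycle is itself nonsingular, hence lies in `sDP`, and its number
      -- of variables is already determined.
      obtain ⟨z, hz, rfl⟩ := hiso.exists_eq_cycleOn
      have := hF.card_vars_eq
        ⟨(hF.of_reduces hr).1, ClauseSet.nonsingular_cycleOn hz, hr⟩ hF₀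
      rw [hcard, ClauseSet.card_vars_cycleOn hz] at this
      exact this
    · rintro rfl
      obtain ⟨z, hz, rfl⟩ := hall F₀ hF₀
      exact ⟨hn, _, hF₀.2.2, ClauseSet.iso_cycle hz⟩
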